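/- Let $d\ge 1$, let $u_1,\dots,u_d$ be linearly independent vectors in $\mathbb R^d$, let $L=\mathbb Z u_1+\dots+\mathbb Z u_d$, let $T^d=\mathbb R^d/L$ be the corresponding flat torus and $\varphi:\mathbb R^d\to T^d$ the projection. A codimension-one subtorus of $T^d$ is a closed subset of the form $\varphi(K)$, where $K\subset\mathbb R^d$ is an affine hyperplane. For $n\ge 1$ let $F(T^d,n)$ be the set of all numbers that occur as the number of connected components of $T^d\setminus (A_1\cup\dots\cup A_n)$, where $A_1,\dots,A_n$ are pairwise distinct codimension-one subtori of $T^d$. Then the following hold (in each of these cases all the numbers in question are, in particular, finite): 1. if $n>d\ge 2$, then $F(T^d,n)=\{\,l\in\mathbb N : n-d+1\le l\le n\ \text{ or }\ l\ge 2(n-d)\,\}$; 2. if $2\le n\le d$, then $F(T^d,n)=\{1,2,3,\dots\}$ is the set of all positive integers; 3. if $n=1$ (and $d\ge 1$), then $F(T^d,1)=\{1\}$. -/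

import Mathlib

/-- The lattice `L` of all integer linear combinations of the basis vectors `u₁, …, u_d` of `ℝᵈ`. -/
def torusLattice {d : ℕ} (u : Module.Basis (Fin d) ℝ (EuclideanSpace ℝ (Fin d))) :
    AddSubgroup (EuclideanSpace ℝ (Fin d)) :=
  (Submodule.span ℤ (Set.range u)).toAddSubgroup

/-- The flat torus `ℝᵈ / L`, with Mathlib's quotient topology. -/
abbrev FlatTorus {d : ℕ} (u : Module.Basis (Fin d) ℝ (EuclideanSpace ℝ (Fin d))) : Type :=
  EuclideanSpace ℝ (Fin d) ⧸ torusLattice u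

/-- The projection `φ : ℝᵈ → ℝᵈ / L`. -/
def torusProj {d : ℕ} (u : Module.Basis (Fin d) ℝ (EuclideanSpace ℝ (Fin d)))
    (x : EuclideanSpace ℝ (Fin d)) : FlatTorus u :=
  QuotientAddGroup.mk x

/-- The affine hyperplane `∑ aᵢ xᵢ = c`, where `xᵢ` are the coordinates with respect to `u`
(a hyperplane when `a ≠ 0`). -/
def coordHyperplane {d : ℕ} (u : Module.Basis (Fin d) ℝ (EuclideanSpace ℝ (Fin d)))
    (a : Fin d → ℝ) (c : ℝ) : Set (EuclideanSpace ℝ (Fin d)) :=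
  {x | ∑ i, a i * u.repr x i = c}

/-- A codimension-one subtorus of `ℝᵈ / L`: a closed subset that is the image `φ(K)` of an affine
hyperplane `K` of `ℝᵈ`. (Such an image is automatically connected.) -/
def IsCodimOneSubtorus {d : ℕ} (u : Module.Basis (Fin d) ℝ (EuclideanSpace ℝ (Fin d)))
    (S : Set (FlatTorus u)) : Prop :=
  IsClosed S ∧ ∃ (a : Fin d → ℝ) (c : ℝ), a ≠ 0 ∧ S = torusProj u '' coordHyperplane u a c

/-- The number of connected components of the complement of the union of the sets `A i`, as an
element of `ℕ ∪ {∞}`. -/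
noncomputable def numComplementComponents {X ι : Type*} [TopologicalSpace X]
    (A : ι → Set X) : ℕ∞ :=
  ENat.card (ConnectedComponents ↥((⋃ i, A i)ᶜ))

/-- The set `F(Tᵈ, n)` of all numbers of connected components of complements of arrangements of
`n` pairwise distinct codimension-one subtori in the flat torus `ℝᵈ / L`. -/
def componentNumbers {d : ℕ} (u : Module.Basis (Fin d) ℝ (EuclideanSpace ℝ (Fin d)))
    (n : ℕ) : Set ℕ∞ :=
  {f | ∃ A : Fin n → Set (FlatTorus u), Function.Injective A ∧
    (∀ i, IsCodimOneSubtorus u (A i)) ∧ numComplementComponents A = f}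

/-! Closedness makes each subtorus the image of `a x - c ∈ ℤ` for a linear form `a` that is integral
on `L` and takes the value 1 there. A cell, on which all floors `⌊a i x - c i⌋` are fixed, is
convex, so the components of the complement are the cells up to translation by `L`
(`IsArrangement.mk_proj_eq_iff`). The problem becomes one of counting floor vectors modulo `L`.

Lower bounds come from deletion and restriction (`AtLeast.insert`). If `a h` depends on the other
forms, it is bounded on every cell, so each old region has a lowest slab with respect to `a h`; the
regions just above the pieces of the hyperplane `h` are never lowest, hence are new. Starting from a
basis of the forms, this gives at least `1 + (n - r)` regions, where `r ≤ d` is the rank.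

The gap is the dichotomy `IsArrangement.atLeast_or_atMost`: at least `2(n - r)` regions or at most
`n`. Without parallel hyperplanes, corank at least two always leaves a dependent hyperplane that is
cut into two pieces, and induction applies. With a parallel class `K`, a hyperplane outside `K` and
a basis `J` is cut into at least `|K|` pieces; if there is none, the count is at most `|K|` or at
least `2|K|`, according to whether `L` maps onto `ℤ^J`.

All remaining values are attained: `m` parallel coordinate hyperplanes together with other
coordinate hyperplanes give `m` regions (`card_components_grid`), and adding an oblique hyperplane
`k x_o + x_p = 1/2` gives `2m + k` (`card_components_oblique`, and `card_components_two` for `m =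
0`). -/

namespace ToralArrangement

open Module Filter Topology

/-! ### Floor vectors, perturbation, deletion and restriction. -/

section Regions

section LinearForms

variable {V : Type*} [AddCommGroup V] [Module ℝ V] {ι : Type*}

/-- A linear form outside the span of finitely many others takes the value `1` somewhere on their
common kernel. -/
theorem exists_apply_eq_one (g : ι → Dual ℝ V) (t : Finset ι) {f : Dual ℝ V}
    (hf : f ∉ Submodule.span ℝ (g '' t)) : ∃ x, (∀ j ∈ t, g j x = 0) ∧ f x = 1 := by
  classical
  by_contra hcon
  push Not at hcon
  apply hf
  have key : f ∈ Submodule.span ℝ (Set.range fun j : t => g j) := by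
    apply mem_span_of_iInf_ker_le_ker
    intro x hx
    simp only [Submodule.mem_iInf, LinearMap.mem_ker, Subtype.forall] at hx
    rw [LinearMap.mem_ker]
    by_contra hfx
    refine hcon ((f x)⁻¹ • x) (fun j hj => by simp [hx j hj]) ?_
    simp [hfx]
  convert key using 2
  ext; simp

/-- Linearly independent forms take arbitrary values simultaneously. -/
theorem exists_apply_eq (g : ι → Dual ℝ V) (t : Finset ι) (hg : LinearIndepOn ℝ g (t : Set ι))
    (y : ι → ℝ) : ∃ x, ∀ j ∈ t, g j x = y j := by
  classical
  have h : ∀ i, ∃ x, i ∈ t → (∀ j ∈ t, j ≠ i → g j x = 0) ∧ g i x = 1 := by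
    intro i
    by_cases hi : i ∈ t
    · have := (linearIndepOn_iff_notMem_span.1 hg) i hi
      obtain ⟨x, hx, hx1⟩ := exists_apply_eq_one g (t.erase i) (f := g i) (by simpa using this)
      exact ⟨x, fun _ => ⟨fun j hj hji => hx j (by simp [hj, hji]), hx1⟩⟩
    · exact ⟨0, fun h => absurd h hi⟩
  choose x hx using h
  refine ⟨∑ i ∈ t, y i • x i, fun j hj => ?_⟩
  rw [map_sum, Finset.sum_eq_single j]
  · simp [(hx j hj).2]
  · intro i hi hij
    simp [(hx i hi).1 j hj hij.symm]
  · intro h; exact absurd hj h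

/-- Two nonproportional linear forms take arbitrary values simultaneously. -/
theorem exists_apply_eq_pair {f g : Dual ℝ V} (hg : g ≠ 0) (h : ∀ r : ℝ, f ≠ r • g) (α β : ℝ) :
    ∃ x, f x = α ∧ g x = β := by
  have hf : f ∉ Submodule.span ℝ ((fun _ : Unit => g) '' (({()} : Finset Unit) : Set Unit)) := by
    simp only [Finset.coe_singleton, Set.image_singleton, Submodule.mem_span_singleton]
    rintro ⟨r, hr⟩
    exact h r hr.symm
  obtain ⟨x, hx, hx1⟩ := exists_apply_eq_one (fun _ : Unit => g) {()} hf
  have hx0 : g x = 0 := hx () (by simp)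
  obtain ⟨w, hw⟩ : ∃ w, g w ≠ 0 := by
    by_contra hcon
    push Not at hcon
    exact hg (LinearMap.ext hcon)
  refine ⟨(α - f w * (β / g w)) • x + (β / g w) • w, ?_, ?_⟩
  · simp [hx1]; ring
  · simp [hx0, hw]

end LinearForms

variable {V : Type*} [AddCommGroup V] [Module ℝ V] {ι : Type*}

/-- Two points have the same position, up to a translation in `L`, with respect to the affine
hyperplanes `a i x - c i ∈ ℤ`, `i ∈ s`. -/
def RegionEquiv (L : AddSubgroup V) (a : ι → Dual ℝ V) (c : ι → ℝ) (s : Finset ι) (x y : V) :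
    Prop :=
  ∃ l ∈ L, ∀ i ∈ s, ⌊a i x - c i⌋ = ⌊a i (y + l) - c i⌋

/-- The hyperplanes `a i x - c i ∈ ℤ`, `i ∈ s`, avoid the point `x`. -/
def Generic (a : ι → Dual ℝ V) (c : ι → ℝ) (s : Finset ι) (x : V) : Prop :=
  ∀ i ∈ s, ∀ z : ℤ, a i x - c i ≠ z

/-- There are at least `k` regions. -/
def AtLeast (L : AddSubgroup V) (a : ι → Dual ℝ V) (c : ι → ℝ) (k : ℕ) (s : Finset ι) : Prop :=
  ∃ p : Fin k → V, (∀ α, Generic a c s (p α)) ∧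
    ∀ α β, RegionEquiv L a c s (p α) (p β) → α = β

/-- The hyperplane `a h x = c h` is cut into at least `k` pieces, up to translations. -/
def AtLeastOn (L : AddSubgroup V) (a : ι → Dual ℝ V) (c : ι → ℝ) (k : ℕ) (s : Finset ι) (h : ι) :
    Prop :=
  ∃ p : Fin k → V, (∀ α, a h (p α) = c h ∧ ∀ i ∈ s, i ≠ h → ∀ z : ℤ, a i (p α) - c i ≠ z) ∧
    ∀ α β, (∃ l ∈ L, a h l = 0 ∧ ∀ i ∈ s, i ≠ h → ⌊a i (p α) - c i⌋ = ⌊a i (p β + l) - c i⌋) →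
      α = β

/-- There are at most `k` regions. -/
def AtMost (L : AddSubgroup V) (a : ι → Dual ℝ V) (c : ι → ℝ) (k : ℕ) (s : Finset ι) : Prop :=
  ∃ F : V → Fin k, ∀ x y, Generic a c s x → Generic a c s y → F x = F y → RegionEquiv L a c s x y

/-- Distinct primitive hyperplanes, with signs normalised so that parallel hyperplanes have the
same linear form. -/
structure IsArrangement (L : AddSubgroup V) (a : ι → Dual ℝ V) (c : ι → ℝ) : Prop where
  integral : ∀ i, ∀ l ∈ L, ∃ z : ℤ, a i l = z
  primitive : ∀ i, ∃ l ∈ L, a i l = 1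
  eq_of_proportional : ∀ i j, ∀ r : ℝ, a i = r • a j → a i = a j
  distinct : ∀ i j, i ≠ j → a i = a j → ∀ z : ℤ, c i - c j ≠ z

section Floor

theorem floor_eq_of_near {y : ℝ} (hy : ∀ z : ℤ, y ≠ z) :
    ∀ᶠ t : ℝ in 𝓝 y, ⌊t⌋ = ⌊y⌋ ∧ ∀ z : ℤ, t ≠ z := by
  have h1 : (⌊y⌋ : ℝ) < y := lt_of_le_of_ne (Int.floor_le y) (hy _).symm
  filter_upwards [Ioo_mem_nhds h1 (Int.lt_floor_add_one y)] with t ht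
  have : ⌊t⌋ = ⌊y⌋ := Int.floor_eq_iff.2 ⟨ht.1.le, ht.2⟩
  refine ⟨this, fun z hz => ?_⟩
  rw [hz, Int.floor_intCast] at this
  rw [hz, this] at ht
  exact lt_irrefl _ ht.1

theorem floor_eq_of_near_right (y : ℝ) :
    ∀ᶠ t : ℝ in 𝓝[>] y, ⌊t⌋ = ⌊y⌋ ∧ ∀ z : ℤ, t ≠ z := by
  filter_upwards [Ioo_mem_nhdsGT (Int.lt_floor_add_one y)] with t ht
  have h1 := Int.floor_le y
  have : ⌊t⌋ = ⌊y⌋ := Int.floor_eq_iff.2 ⟨h1.trans ht.1.le, ht.2⟩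
  refine ⟨this, fun z hz => ?_⟩
  rw [hz, Int.floor_intCast] at this
  rw [hz, this] at ht
  linarith [ht.1]

/-- The floor is right-continuous, so a small upward move is harmless even from an integer. -/
theorem eventually_floor (y v : ℝ) (h : 0 ≤ v ∨ ∀ z : ℤ, y ≠ z) :
    ∀ᶠ ε in 𝓝[>] (0 : ℝ), ⌊y + ε * v⌋ = ⌊y⌋ := by
  have hc : Tendsto (fun ε : ℝ => y + ε * v) (𝓝[>] 0) (𝓝 y) := by
    have : Continuous fun ε : ℝ => y + ε * v := by fun_prop
    simpa using (this.tendsto 0).mono_left nhdsWithin_le_nhds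
  by_cases hg : ∀ z : ℤ, y ≠ z
  · exact (hc.eventually (floor_eq_of_near hg)).mono fun _ h => h.1
  · rcases (h.resolve_right hg).eq_or_lt with rfl | hv
    · simp
    · have : Tendsto (fun ε : ℝ => y + ε * v) (𝓝[>] 0) (𝓝[>] y) := by
        refine tendsto_nhdsWithin_iff.2 ⟨hc, ?_⟩
        filter_upwards [self_mem_nhdsWithin] with ε hε
        have : 0 < ε * v := mul_pos hε hv
        simpa using this
      exact (this.eventually (floor_eq_of_near_right y)).mono fun _ h => h.1

theorem eventually_ne_int (y v : ℝ) (h : v ≠ 0 ∨ ∀ z : ℤ, y ≠ z) :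
    ∀ᶠ ε in 𝓝[>] (0 : ℝ), ∀ z : ℤ, y + ε * v ≠ z := by
  have hc : Tendsto (fun ε : ℝ => y + ε * v) (𝓝[>] 0) (𝓝 y) := by
    have : Continuous fun ε : ℝ => y + ε * v := by fun_prop
    simpa using (this.tendsto 0).mono_left nhdsWithin_le_nhds
  by_cases hg : ∀ z : ℤ, y ≠ z
  · exact (hc.eventually (floor_eq_of_near hg)).mono fun _ h => h.2
  · rcases lt_or_gt_of_ne (h.resolve_right hg) with hv | hv
    · have : Tendsto (fun ε : ℝ => -(y + ε * v)) (𝓝[>] 0) (𝓝[>] (-y)) := by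
        refine tendsto_nhdsWithin_iff.2 ⟨hc.neg, ?_⟩
        filter_upwards [self_mem_nhdsWithin] with ε hε
        have : ε * v < 0 := mul_neg_of_pos_of_neg hε hv
        simpa using this
      refine (this.eventually (floor_eq_of_near_right (-y))).mono fun _ h z hz => ?_
      exact h.2 (-z) (by simp [hz])
    · have : Tendsto (fun ε : ℝ => y + ε * v) (𝓝[>] 0) (𝓝[>] y) := by
        refine tendsto_nhdsWithin_iff.2 ⟨hc, ?_⟩
        filter_upwards [self_mem_nhdsWithin] with ε hε
        have : 0 < ε * v := mul_pos hε hv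
        simpa using this
      exact (this.eventually (floor_eq_of_near_right y)).mono fun _ h => h.2

end Floor

section Basic

variable {L : AddSubgroup V} {a : ι → Dual ℝ V} {c : ι → ℝ}

theorem RegionEquiv.mono {s t : Finset ι} (hts : t ⊆ s) {x y : V}
    (h : RegionEquiv L a c s x y) : RegionEquiv L a c t x y := by
  obtain ⟨l, hl, h⟩ := h
  exact ⟨l, hl, fun i hi => h i (hts hi)⟩

theorem floor_add_of_integral {z : ℤ} (i : ι) {l : V} (h : a i l = z) (x : V) :
    ⌊a i (x + l) - c i⌋ = ⌊a i x - c i⌋ + z := by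
  rw [map_add, h, add_sub_right_comm, Int.floor_add_intCast]

theorem IsArrangement.ne_zero (hA : IsArrangement L a c) (i : ι) : a i ≠ 0 := by
  intro h
  obtain ⟨l, -, hl⟩ := hA.primitive i
  simp [h] at hl

theorem IsArrangement.ne_smul (hA : IsArrangement L a c) {i j : ι} (h : a i ≠ a j) (r : ℝ) :
    a i ≠ r • a j := fun h' => h (hA.eq_of_proportional i j r h')

theorem IsArrangement.floor_add_congr (hA : IsArrangement L a c) (i : ι) {l : V} (hl : l ∈ L)
    {x y : V} (h : ⌊a i x - c i⌋ = ⌊a i y - c i⌋) :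
    ⌊a i (x + l) - c i⌋ = ⌊a i (y + l) - c i⌋ := by
  obtain ⟨z, hz⟩ := hA.integral i l hl
  rw [floor_add_of_integral i hz, floor_add_of_integral i hz, h]

theorem IsArrangement.regionEquiv_symm (hA : IsArrangement L a c) {s : Finset ι} {x y : V}
    (h : RegionEquiv L a c s x y) : RegionEquiv L a c s y x := by
  obtain ⟨l, hl, h⟩ := h
  refine ⟨-l, L.neg_mem hl, fun i hi => ?_⟩
  have := hA.floor_add_congr i (L.neg_mem hl) (h i hi)
  rw [this]; simp

theorem IsArrangement.regionEquiv_trans (hA : IsArrangement L a c) {s : Finset ι} {x y w : V}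
    (h : RegionEquiv L a c s x y) (h' : RegionEquiv L a c s y w) : RegionEquiv L a c s x w := by
  obtain ⟨l, hl, h⟩ := h
  obtain ⟨m, hm, h'⟩ := h'
  refine ⟨m + l, L.add_mem hm hl, fun i hi => ?_⟩
  rw [h i hi, hA.floor_add_congr i hl (h' i hi), add_assoc]

theorem regionEquiv_of_floor {s : Finset ι} {x y : V}
    (h : ∀ i ∈ s, ⌊a i x - c i⌋ = ⌊a i y - c i⌋) : RegionEquiv L a c s x y :=
  ⟨0, L.zero_mem, by simpa using h⟩

/-- The perturbation tool: a single small step along `v` serves all of `s`. It keeps the floor of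
every form that is not at an integer or does not decrease, and leaves every hyperplane transverse to
`v`. -/
theorem exists_push (s : Finset ι) (x v : V) :
    ∃ ε : ℝ, 0 < ε ∧ ∀ i ∈ s,
      ((0 ≤ a i v ∨ ∀ z : ℤ, a i x - c i ≠ z) →
        ⌊a i (x + ε • v) - c i⌋ = ⌊a i x - c i⌋) ∧
      ((a i v ≠ 0 ∨ ∀ z : ℤ, a i x - c i ≠ z) → ∀ z : ℤ, a i (x + ε • v) - c i ≠ z) := by
  have hrw : ∀ i, ∀ ε : ℝ, a i (x + ε • v) - c i = (a i x - c i) + ε * a i v := by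
    intro i ε
    simp; ring
  have h : ∀ᶠ ε in 𝓝[>] (0 : ℝ), ∀ i ∈ s,
      ((0 ≤ a i v ∨ ∀ z : ℤ, a i x - c i ≠ z) →
        ⌊a i (x + ε • v) - c i⌋ = ⌊a i x - c i⌋) ∧
      ((a i v ≠ 0 ∨ ∀ z : ℤ, a i x - c i ≠ z) → ∀ z : ℤ, a i (x + ε • v) - c i ≠ z) := by
    rw [Filter.eventually_all_finset]
    intro i _
    simp only [hrw]
    refine Filter.Eventually.and ?_ ?_
    · by_cases h : 0 ≤ a i v ∨ ∀ z : ℤ, a i x - c i ≠ z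
      · exact (eventually_floor _ _ h).mono fun _ h _ => h
      · exact Filter.Eventually.of_forall fun _ h' => absurd h' h
    · by_cases h : a i v ≠ 0 ∨ ∀ z : ℤ, a i x - c i ≠ z
      · exact (eventually_ne_int _ _ h).mono fun _ h _ => h
      · exact Filter.Eventually.of_forall fun _ h' => absurd h' h
  obtain ⟨ε, h1, h2⟩ := (h.and self_mem_nhdsWithin).exists
  exact ⟨ε, h2, h1⟩

theorem IsArrangement.exists_direction (hA : IsArrangement L a c) (s : Finset ι) :
    ∃ v, ∀ i ∈ s, a i v ≠ 0 := by
  obtain ⟨v, hv⟩ := Module.Dual.exists_forall_ne_zero_of_forall_exists (fun i : s => a i)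
    fun i => by
      obtain ⟨l, -, hl⟩ := hA.primitive i
      exact ⟨l, by simp [hl]⟩
  exact ⟨v, fun i hi => hv ⟨i, hi⟩⟩

theorem IsArrangement.exists_direction_on (hA : IsArrangement L a c) (s : Finset ι) (h : ι) :
    ∃ v, a h v = 0 ∧ ∀ i ∈ s, a i ≠ a h → a i v ≠ 0 := by
  classical
  obtain ⟨v, hv, hv'⟩ := Module.Dual.exists_forall_mem_ne_zero_of_forall_exists
    (LinearMap.ker (a h)) (fun i : s.filter (fun i => a i ≠ a h) => a i)
    fun i => by
      have hi := (Finset.mem_filter.1 i.2).2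
      obtain ⟨x, hx, hx'⟩ := exists_apply_eq_pair (hA.ne_zero h) (hA.ne_smul hi) 1 0
      exact ⟨x, hx', by simp [hx]⟩
  exact ⟨v, hv, fun i hi hih => hv' ⟨i, by simp [hi, hih]⟩⟩

theorem IsArrangement.exists_generic_near (hA : IsArrangement L a c) {s t : Finset ι}
    (hts : t ⊆ s) {x : V} (hx : Generic a c t x) :
    ∃ y, Generic a c s y ∧ ∀ i ∈ t, ⌊a i y - c i⌋ = ⌊a i x - c i⌋ := by
  obtain ⟨v, hv⟩ := hA.exists_direction s
  obtain ⟨ε, -, h⟩ := exists_push (c := c) (a := a) s x v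
  exact ⟨x + ε • v, fun i hi => (h i hi).2 (Or.inl (hv i hi)),
    fun i hi => (h i (hts hi)).1 (Or.inr (hx i hi))⟩

theorem IsArrangement.ne_int_of_parallel (hA : IsArrangement L a c) {h i : ι} (hih : i ≠ h)
    (hp : a i = a h) {x : V} (hx : a h x = c h) (z : ℤ) : a i x - c i ≠ z := by
  rw [hp, hx]
  exact hA.distinct h i hih.symm hp.symm z

/-- More hyperplanes only refine the regions: representatives are pushed off the new hyperplanes
without leaving their old cells. -/
theorem AtLeast.mono (hA : IsArrangement L a c) {s t : Finset ι} (hts : t ⊆ s) {k : ℕ}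
    (h : AtLeast L a c k t) : AtLeast L a c k s := by
  obtain ⟨p, hp, hp'⟩ := h
  choose q hq hq' using fun α => hA.exists_generic_near hts (hp α)
  refine ⟨q, hq, fun α β h => hp' α β ?_⟩
  exact hA.regionEquiv_trans (regionEquiv_of_floor fun i hi => (hq' α i hi).symm)
    (hA.regionEquiv_trans (h.mono hts) (regionEquiv_of_floor fun i hi => hq' β i hi))

/-- The push stays inside the hyperplane `h`. It cannot be transverse to the parallels of `h`, but
these never meet `h`. -/
theorem AtLeastOn.mono (hA : IsArrangement L a c) {s t : Finset ι} (hts : t ⊆ s) {k : ℕ} {h : ι}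
    (hk : AtLeastOn L a c k t h) : AtLeastOn L a c k s h := by
  obtain ⟨p, hp, hp'⟩ := hk
  obtain ⟨v, hv0, hv⟩ := hA.exists_direction_on s h
  choose ε hε0 hε using fun α => exists_push (c := c) (a := a) s (p α) v
  refine ⟨fun α => p α + ε α • v, fun α => ⟨by simp [hv0, (hp α).1], fun i hi hih => ?_⟩,
    fun α β hl => hp' α β ?_⟩
  · by_cases hpar : a i = a h
    · exact hA.ne_int_of_parallel hih hpar (by simp [hv0, (hp α).1])
    · exact (hε α i hi).2 (Or.inl (hv i hi hpar))
  · obtain ⟨l, hl, hl0, hl'⟩ := hl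
    refine ⟨l, hl, hl0, fun i hi hih => ?_⟩
    rw [← (hε α i (hts hi)).1 (Or.inr ((hp α).2 i hi hih)), hl' i (hts hi) hih]
    exact hA.floor_add_congr i hl ((hε β i (hts hi)).1 (Or.inr ((hp β).2 i hi hih)))

theorem AtLeast.of_le {k m : ℕ} (hmk : m ≤ k) {s : Finset ι} (h : AtLeast L a c k s) :
    AtLeast L a c m s := by
  obtain ⟨p, hp, hp'⟩ := h
  refine ⟨fun α => p (Fin.castLE hmk α), fun α => hp _, fun α β h => ?_⟩
  exact Fin.castLE_injective hmk (hp' _ _ h)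

theorem AtLeast.of_fintype {κ : Type*} [Fintype κ] {s : Finset ι} (p : κ → V)
    (hp : ∀ α, Generic a c s (p α)) (hp' : ∀ α β, RegionEquiv L a c s (p α) (p β) → α = β) :
    AtLeast L a c (Fintype.card κ) s :=
  ⟨p ∘ (Fintype.equivFin κ).symm, fun _ => hp _, fun α β h => by simpa using hp' _ _ h⟩

theorem AtLeastOn.of_fintype {κ : Type*} [Fintype κ] {s : Finset ι} {h : ι} (p : κ → V)
    (hp : ∀ α, a h (p α) = c h ∧ ∀ i ∈ s, i ≠ h → ∀ z : ℤ, a i (p α) - c i ≠ z)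
    (hp' : ∀ α β, (∃ l ∈ L, a h l = 0 ∧
      ∀ i ∈ s, i ≠ h → ⌊a i (p α) - c i⌋ = ⌊a i (p β + l) - c i⌋) → α = β) :
    AtLeastOn L a c (Fintype.card κ) s h :=
  ⟨p ∘ (Fintype.equivFin κ).symm, fun _ => hp _, fun α β h => by simpa using hp' _ _ h⟩

theorem IsArrangement.atLeast_one (hA : IsArrangement L a c) (s : Finset ι) :
    AtLeast L a c 1 s :=
  AtLeast.mono hA (Finset.empty_subset s)
    ⟨fun _ => 0, fun _ i hi => by simp at hi, fun _ _ _ => Subsingleton.elim _ _⟩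

theorem IsArrangement.atLeastOn_one (hA : IsArrangement L a c) (s : Finset ι) (h : ι) :
    AtLeastOn L a c 1 s h := by
  obtain ⟨l, -, hl⟩ := hA.primitive h
  exact AtLeastOn.mono hA (Finset.empty_subset s)
    ⟨fun _ => c h • l, fun _ => ⟨by simp [hl], fun i hi => by simp at hi⟩,
      fun _ _ _ => Subsingleton.elim _ _⟩

/-- Deletion and restriction: a hyperplane whose linear form depends on the others adds at least
as many regions as the pieces into which it is cut. -/
theorem AtLeast.insert [DecidableEq ι] (hA : IsArrangement L a c) {s : Finset ι} {h : ι}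
    (hs : h ∉ s) (hspan : a h ∈ Submodule.span ℝ (a '' s)) {k m : ℕ}
    (hk : AtLeast L a c k s) (hm : AtLeastOn L a c m s h) :
    AtLeast L a c (k + m) (insert h s) := by
  obtain ⟨p, hp, hp'⟩ := hk
  obtain ⟨e, he, he'⟩ := hm
  obtain ⟨w, hw⟩ : ∃ w : ι → ℝ, a h = ∑ i ∈ s, w i • a i := by
    obtain ⟨w, hw⟩ := Submodule.mem_span_image_finset_iff_exists_fun ℝ |>.1 hspan
    refine ⟨fun i => if hi : i ∈ s then w ⟨i, hi⟩ else 0, ?_⟩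
    rw [← hw, ← Finset.sum_coe_sort s]
    simp
  -- In each old cell choose a point in the lowest slab of `a h`. It exists because `a h = ∑ w i • a
  -- i` and each `a i` varies by at most 1 on a cell, so `a h` drops by at most `∑ |w i|`.
  have hmin : ∀ α, ∃ q, Generic a c (Insert.insert h s) q ∧
      (∀ i ∈ s, ⌊a i q - c i⌋ = ⌊a i (p α) - c i⌋) ∧
      ∀ x, (∀ i ∈ s, ⌊a i x - c i⌋ = ⌊a i (p α) - c i⌋) →
        Generic a c (Insert.insert h s) x → ⌊a h q - c h⌋ ≤ ⌊a h x - c h⌋ := by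
    intro α
    let P : ℤ → Prop := fun z => ∃ q, Generic a c (Insert.insert h s) q ∧
      (∀ i ∈ s, ⌊a i q - c i⌋ = ⌊a i (p α) - c i⌋) ∧ ⌊a h q - c h⌋ = z
    have hne : ∃ z, P z := by
      obtain ⟨y, hy, hy'⟩ := hA.exists_generic_near (Finset.subset_insert h s) (hp α)
      exact ⟨_, y, hy, hy', rfl⟩
    have hbd : ∃ b : ℤ, ∀ z, P z → b ≤ z := by
      refine ⟨⌊(a h (p α) - ∑ i ∈ s, |w i|) - c h⌋, ?_⟩
      rintro z ⟨q, -, hq, rfl⟩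
      apply Int.floor_le_floor
      have : a h (p α) - a h q ≤ ∑ i ∈ s, |w i| := by
        rw [hw]
        simp only [LinearMap.sum_apply, LinearMap.smul_apply, smul_eq_mul,
          ← Finset.sum_sub_distrib, ← mul_sub]
        refine Finset.sum_le_sum fun i hi => ?_
        have h1 : |a i (p α) - a i q| ≤ 1 := by
          have := Int.abs_sub_lt_one_of_floor_eq_floor (hq i hi)
          rw [abs_sub_comm]
          have h2 : a i q - c i - (a i (p α) - c i) = a i q - a i (p α) := by ring
          rw [h2] at this
          exact this.le
        calc w i * (a i (p α) - a i q) ≤ |w i * (a i (p α) - a i q)| := le_abs_self _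
          _ = |w i| * |a i (p α) - a i q| := abs_mul _ _
          _ ≤ |w i| * 1 := by gcongr
          _ = |w i| := mul_one _
      linarith
    obtain ⟨z, ⟨q, hq1, hq2, hq3⟩, hz⟩ := Int.exists_least_of_bdd hbd hne
    exact ⟨q, hq1, hq2, fun x hx hx' => hq3 ▸ hz _ ⟨x, hx', hx, rfl⟩⟩
  choose q hq1 hq2 hq3 using hmin
  obtain ⟨v, -, hv⟩ := hA.primitive h
  choose ε hε0 hε using fun β => exists_push (c := c) (a := a) (Insert.insert h s) (e β) v
  -- `y β` lies just below the piece `e β`, and `e' β` just above it: the same old cell, slabs `-1`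
  -- and `0`.
  have hε' : ∀ β, ∃ y, Generic a c (Insert.insert h s) y ∧
      (∀ i ∈ s, ⌊a i y - c i⌋ = ⌊a i (e β) - c i⌋) ∧ ⌊a h y - c h⌋ = -1 := by
    intro β
    have hgen : ∀ i ∈ s, ∀ z : ℤ, a i (e β) - c i ≠ z :=
      fun i hi => (he β).2 i hi (fun h' => hs (h' ▸ hi))
    obtain ⟨δ', hδ'0, hδ'⟩ : ∃ δ' : ℝ, (0 < δ' ∧ δ' < 1) ∧ ∀ i ∈ s,
        ⌊a i (e β + δ' • (-v)) - c i⌋ = ⌊a i (e β) - c i⌋ ∧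
          ∀ z : ℤ, a i (e β + δ' • (-v)) - c i ≠ z := by
      have h1 : ∀ᶠ ε in 𝓝[>] (0 : ℝ), ∀ i ∈ s,
          ⌊(a i (e β) - c i) + ε * a i (-v)⌋ = ⌊a i (e β) - c i⌋ ∧
          ∀ z : ℤ, (a i (e β) - c i) + ε * a i (-v) ≠ z := by
        rw [Filter.eventually_all_finset]
        exact fun i hi => (eventually_floor _ _ (Or.inr (hgen i hi))).and
          (eventually_ne_int _ _ (Or.inr (hgen i hi)))
      obtain ⟨ε, h1, h2⟩ := (h1.and (Ioo_mem_nhdsGT (zero_lt_one (α := ℝ)))).exists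
      refine ⟨ε, h2, fun i hi => ?_⟩
      have hrw : a i (e β + ε • (-v)) - c i = (a i (e β) - c i) + ε * a i (-v) := by
        simp only [map_add, map_smul, smul_eq_mul]; ring
      rw [hrw]
      exact h1 i hi
    have hval : a h (e β + δ' • (-v)) - c h = -δ' := by
      simp [hv, (he β).1]
    have hfl : ⌊a h (e β + δ' • (-v)) - c h⌋ = -1 := by
      rw [hval, Int.floor_eq_iff]
      constructor <;> push_cast <;> linarith [hδ'0.1, hδ'0.2]
    refine ⟨e β + δ' • (-v), ?_, fun i hi => (hδ' i hi).1, hfl⟩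
    intro i hi z hz
    rcases Finset.mem_insert.1 hi with rfl | hi
    · rw [hz, Int.floor_intCast] at hfl
      rw [hfl, hval] at hz
      push_cast at hz
      linarith [hδ'0.2]
    · exact (hδ' i hi).2 z hz
  choose y hy1 hy2 hy3 using hε'
  let e' : Fin m → V := fun β => e β + ε β • v
  have he'gen : ∀ β, Generic a c (Insert.insert h s) (e' β) := by
    intro β i hi
    rcases Finset.mem_insert.1 hi with rfl | hi'
    · exact (hε β i hi).2 (Or.inl (by simp [hv]))
    · exact (hε β i hi).2 (Or.inr ((he β).2 i hi' (fun h' => hs (h' ▸ hi'))))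
  have he'fl : ∀ β, ∀ i ∈ s, ⌊a i (e' β) - c i⌋ = ⌊a i (e β) - c i⌋ := by
    intro β i hi
    exact (hε β i (Finset.mem_insert_of_mem hi)).1
      (Or.inr ((he β).2 i hi (fun h' => hs (h' ▸ hi))))
  have he'h : ∀ β, ⌊a h (e' β) - c h⌋ = 0 := by
    intro β
    have := (hε β h (Finset.mem_insert_self h s)).1 (Or.inl (by simp [hv]))
    rw [this, (he β).1]; simp
  -- If a translate of `e' β` were in the lowest slab, the same translate of `y β` would be one slab
  -- lower in the same old cell.
  have hcross : ∀ α β, ¬ RegionEquiv L a c (Insert.insert h s) (q α) (e' β) := by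
    rintro α β ⟨l, hl, hle⟩
    obtain ⟨z, hz⟩ := hA.integral h l hl
    have h1 := hq3 α (y β + l) (fun i hi => by
      rw [hA.floor_add_congr i hl ((hy2 β i hi).trans (he'fl β i hi).symm),
        ← hle i (Finset.mem_insert_of_mem hi), hq2 α i hi]) (by
      intro i hi z' hz'
      obtain ⟨z'', hz''⟩ := hA.integral i l hl
      refine hy1 β i hi (z' - z'') ?_
      rw [map_add, hz''] at hz'
      push_cast
      linarith)
    rw [hle h (Finset.mem_insert_self h s), floor_add_of_integral h hz,
      floor_add_of_integral h hz, he'h, hy3] at h1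
    omega
  have := AtLeast.of_fintype (L := L) (a := a) (c := c) (s := Insert.insert h s)
    (Sum.elim q e') (by rintro (α | β); exacts [hq1 α, he'gen β]) (by
      rintro (α | α) (β | β) hab
      · congr 1
        apply hp'
        refine hA.regionEquiv_trans (regionEquiv_of_floor fun i hi => (hq2 α i hi).symm)
          (hA.regionEquiv_trans (hab.mono (Finset.subset_insert h s))
            (regionEquiv_of_floor fun i hi => hq2 β i hi))
      · exact absurd hab (hcross α β)
      · exact absurd (hA.regionEquiv_symm hab) (hcross β α)
      · congr 1
        apply he'
        obtain ⟨l, hl, hle⟩ := hab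
        obtain ⟨z, hz⟩ := hA.integral h l hl
        -- Both points have floor `0` for `a h`, so the translation satisfies `a h l = 0` and
        -- identifies pieces of the hyperplane itself.
        refine ⟨l, hl, ?_, fun i hi _ => ?_⟩
        · have := hle h (Finset.mem_insert_self h s)
          simp only [Sum.elim_inr] at this
          rw [floor_add_of_integral h hz, he'h, he'h] at this
          rw [hz, show z = 0 by omega]; simp
        · have := hle i (Finset.mem_insert_of_mem hi)
          simp only [Sum.elim_inr] at this
          rw [← he'fl α i hi, this]
          exact hA.floor_add_congr i hl (he'fl β i hi))
  simpa using this

/-- Insert the hyperplanes of `s \ t` one by one. Each form already depends on those of `t`, and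
cutting by `t` alone guarantees `m` pieces. -/
theorem AtLeast.add_card_mul [DecidableEq ι] (hA : IsArrangement L a c) {s t : Finset ι}
    (hts : t ⊆ s) (hspan : a '' s ⊆ Submodule.span ℝ (a '' t)) {k m : ℕ}
    (hk : AtLeast L a c k t) (hm : ∀ h ∈ s, h ∉ t → AtLeastOn L a c m t h) :
    AtLeast L a c (k + m * (s.card - t.card)) s := by
  have key : ∀ w : Finset ι, Disjoint t w → w ⊆ s →
      AtLeast L a c (k + m * w.card) (t ∪ w) := by
    intro w
    induction w using Finset.induction_on with
    | empty => intro _ _; simpa using hk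
    | insert h w hw ih =>
      intro hd hws
      rw [Finset.disjoint_insert_right] at hd
      have h1 := ih hd.2 ((Finset.subset_insert _ _).trans hws)
      have hhs := hws (Finset.mem_insert_self h w)
      have := AtLeast.insert hA (h := h) (s := t ∪ w) (by simp [hd.1, hw])
        (Submodule.span_mono (Set.image_mono (by simp)) (hspan ⟨h, hhs, rfl⟩)) h1
        ((hm h hhs hd.1).mono hA Finset.subset_union_left)
      rw [Finset.union_insert, Finset.card_insert_of_notMem hw]
      convert this using 1
      ring
  have := key (s \ t) Finset.disjoint_sdiff Finset.sdiff_subset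
  rwa [Finset.union_sdiff_of_subset hts, Finset.card_sdiff_of_subset hts] at this

end Basic

end Regions

/-! ### Arrangements containing a parallel class. -/

section Parallel

variable {V : Type*} [AddCommGroup V] [Module ℝ V] {ι : Type*}
variable {L : AddSubgroup V} {a : ι → Dual ℝ V} {c : ι → ℝ}

section ParallelClass

/-- The offsets cut the circle `ℝ/ℤ` into `|K|` arcs. The sample `y t = c t + ε` lies just after the
cut `c t`, and its floor pattern recovers the arc and the integer translation. -/
theorem exists_offsets (c : ι → ℝ) (K : Finset ι)
    (hc : ∀ i ∈ K, ∀ j ∈ K, i ≠ j → ∀ z : ℤ, c i - c j ≠ z) :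
    ∃ y : ι → ℝ, (∀ t ∈ K, ∀ i ∈ K, ∀ z : ℤ, y t - c i ≠ z) ∧
      ∀ t ∈ K, ∀ t' ∈ K, ∀ z : ℤ, (∀ i ∈ K, ⌊y t - c i⌋ = ⌊y t' + z - c i⌋) → t = t' ∧ z = 0 := by
  have h : ∀ᶠ ε in 𝓝[>] (0 : ℝ), ∀ t ∈ K, ∀ i ∈ K,
      ⌊(c t - c i) + ε * 1⌋ = ⌊c t - c i⌋ ∧ ∀ z : ℤ, (c t - c i) + ε * 1 ≠ z := by
    simp only [Filter.eventually_all_finset]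
    exact fun t _ i _ => (eventually_floor _ _ (Or.inl zero_le_one)).and
      (eventually_ne_int _ _ (Or.inl one_ne_zero))
  obtain ⟨ε, hε⟩ := h.exists
  have hrw : ∀ t i, c t + ε - c i = (c t - c i) + ε * 1 := fun t i => by ring
  refine ⟨fun t => c t + ε, fun t ht i hi => by rw [hrw]; exact (hε t ht i hi).2,
    fun t ht t' ht' z hz => ?_⟩
  have hz' : ∀ i ∈ K, ⌊c t - c i⌋ = ⌊c t' - c i⌋ + z := by
    intro i hi
    have := hz i hi
    rw [hrw, (hε t ht i hi).1, show c t' + ε + z - c i = ((c t' - c i) + ε * 1) + z by ring,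
      Int.floor_add_intCast, (hε t' ht' i hi).1] at this
    exact this
  -- Evaluating at `t` and at `t'` gives `⌊c t - c t'⌋ = z` and `⌊c t' - c t⌋ = -z`; this forces `c
  -- t - c t' = z`.
  have h1 := hz' t ht
  have h2 := hz' t' ht'
  rw [sub_self, Int.floor_zero] at h1 h2
  have h3 := Int.floor_le (c t - c t')
  have h4 := Int.floor_le (c t' - c t)
  have h5 : ⌊c t' - c t⌋ = -z := by omega
  rw [h2] at h3
  rw [h5] at h4
  push_cast at h3 h4
  have h6 : c t - c t' = z := by linarith
  have htt : t = t' := by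
    by_contra hne
    exact hc t ht t' ht' hne z h6
  subst htt
  refine ⟨rfl, ?_⟩
  rw [sub_self] at h6
  exact_mod_cast h6.symm

theorem IsArrangement.exists_class_offsets (hA : IsArrangement L a c) {K : Finset ι} {i₀ : ι}
    (hK : ∀ i ∈ K, a i = a i₀) :
    ∃ y : ι → ℝ, (∀ t ∈ K, ∀ i ∈ K, ∀ z : ℤ, y t - c i ≠ z) ∧
      ∀ t ∈ K, ∀ t' ∈ K, ∀ z : ℤ, (∀ i ∈ K, ⌊y t - c i⌋ = ⌊y t' + z - c i⌋) → t = t' ∧ z = 0 :=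
  exists_offsets c K fun i hi j hj hij => hA.distinct i j hij ((hK i hi).trans (hK j hj).symm)

theorem IsArrangement.atLeast_class (hA : IsArrangement L a c) {K : Finset ι} {i₀ : ι}
    (hK : ∀ i ∈ K, a i = a i₀) : AtLeast L a c K.card K := by
  obtain ⟨y, hy, hy'⟩ := hA.exists_class_offsets hK
  obtain ⟨v, -, hv⟩ := hA.primitive i₀
  have := AtLeast.of_fintype (L := L) (a := a) (c := c) (s := K) (fun t : K => y t • v)
    (fun t i hi => by simpa [hK i hi, hv] using hy t t.2 i hi) (by
      rintro t t' ⟨l, hl, hle⟩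
      obtain ⟨z, hz⟩ := hA.integral i₀ l hl
      refine Subtype.ext (hy' t t.2 t' t'.2 z fun i hi => ?_).1
      simpa [hK i hi, hv, hz] using hle i hi)
  simpa using this

/-- On a hyperplane not parallel to the class, `a i₀` still takes every value, so all `|K|` arcs
occur there. -/
theorem IsArrangement.atLeastOn_class (hA : IsArrangement L a c) {K : Finset ι} {i₀ h : ι}
    (hK : ∀ i ∈ K, a i = a i₀) (hh : a h ≠ a i₀) : AtLeastOn L a c K.card K h := by
  obtain ⟨y, hy, hy'⟩ := hA.exists_class_offsets hK
  choose p hp1 hp2 using fun t => exists_apply_eq_pair (hA.ne_zero i₀) (hA.ne_smul hh) (c h) (y t)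
  have := AtLeastOn.of_fintype (L := L) (a := a) (c := c) (s := K) (h := h) (fun t : K => p t)
    (fun t => ⟨hp1 _, fun i hi _ => by simpa [hK i hi, hp2] using hy t t.2 i hi⟩) (by
      rintro t t' ⟨l, hl, -, hle⟩
      obtain ⟨z, hz⟩ := hA.integral i₀ l hl
      refine Subtype.ext (hy' t t.2 t' t'.2 z fun i hi => ?_).1
      have hih : i ≠ h := by rintro rfl; exact hh (hK i hi)
      simpa [hK i hi, hp2, hz] using hle i hi hih)
  simpa using this

/-- A vector `z` missed by `L → ℤ^J` makes two different regions in each strip: a sample and its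
shift by `z` have floors on `J` that no lattice translation can match. -/
theorem IsArrangement.atLeast_two_mul [DecidableEq ι] (hA : IsArrangement L a c)
    {K J : Finset ι} {i₀ : ι} (hK : ∀ i ∈ K, a i = a i₀) (hi₀ : i₀ ∈ K) (hi₀J : i₀ ∈ J)
    (hJ : LinearIndepOn ℝ a (J : Set ι)) {z : ι → ℤ} (hz : ¬ ∃ l ∈ L, ∀ j ∈ J, a j l = z j) :
    AtLeast L a c (2 * K.card) (K ∪ J) := by
  obtain ⟨y, hy, hy'⟩ := hA.exists_class_offsets hK
  -- Coordinate `i₀` selects the strip `t`, the others sit midway between hyperplanes, and `b ∈ {0,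
  -- 1}` tells whether the shift by `z` is applied.
  choose p hp using fun tb : ι × ℤ => exists_apply_eq a J hJ
    (fun j => (if j = i₀ then y tb.1 else c j + 1 / 2) + (tb.2 * z j : ℤ))
  have hp0 : ∀ t b, a i₀ (p (t, b)) = y t + (b * z i₀ : ℤ) := fun t b => by
    simpa using hp (t, b) i₀ hi₀J
  have hp1 : ∀ t b, ∀ j ∈ J, j ≠ i₀ → a j (p (t, b)) = c j + 1 / 2 + (b * z j : ℤ) :=
    fun t b j hj hji => by simpa [hji] using hp (t, b) j hj
  have hhalf : ∀ m : ℤ, ⌊(1 / 2 : ℝ) + m⌋ = m := fun m => by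
    rw [Int.floor_add_intCast, show ⌊(1 / 2 : ℝ)⌋ = 0 by norm_num]; simp
  have key : ∀ t ∈ K, ∀ t' ∈ K, ∀ b b' : ℤ, ∀ l ∈ L,
      (∀ i ∈ K ∪ J, ⌊a i (p (t, b)) - c i⌋ = ⌊a i (p (t', b') + l) - c i⌋) →
      t = t' ∧ ∀ j ∈ J, a j l = ((b - b') * z j : ℤ) := by
    intro t ht t' ht' b b' l hl hle
    obtain ⟨w, hw⟩ := hA.integral i₀ l hl
    obtain ⟨h1, h2⟩ := hy' t ht t' ht' (b' * z i₀ + w - b * z i₀) fun i hi => by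
      have := hle i (Finset.mem_union_left _ hi)
      rw [hK i hi, map_add, hp0, hp0, hw,
        show y t + (b * z i₀ : ℤ) - c i = (y t - c i) + (b * z i₀ : ℤ) by ring,
        show y t' + (b' * z i₀ : ℤ) + w - c i = (y t' - c i) + (b' * z i₀ + w : ℤ) by
          push_cast; ring, Int.floor_add_intCast, Int.floor_add_intCast] at this
      rw [show y t' + (b' * z i₀ + w - b * z i₀ : ℤ) - c i
        = (y t' - c i) + (b' * z i₀ + w - b * z i₀ : ℤ) by ring, Int.floor_add_intCast]
      omega
    refine ⟨h1, fun j hj => ?_⟩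
    by_cases hji : j = i₀
    · subst hji
      rw [hw, show w = (b - b') * z j by linarith]
    · obtain ⟨w', hw'⟩ := hA.integral j l hl
      have := hle j (Finset.mem_union_right _ hj)
      rw [map_add, hp1 t b j hj hji, hp1 t' b' j hj hji, hw',
        show c j + 1 / 2 + (b * z j : ℤ) - c j = 1 / 2 + (b * z j : ℤ) by ring,
        show c j + 1 / 2 + (b' * z j : ℤ) + w' - c j = 1 / 2 + (b' * z j + w' : ℤ) by
          push_cast; ring, hhalf, hhalf] at this
      rw [hw', show w' = (b - b') * z j by linarith]
  have := AtLeast.of_fintype (L := L) (a := a) (c := c) (s := K ∪ J)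
    (fun tb : K × Fin 2 => p (tb.1, (tb.2 : ℕ))) (by
      rintro ⟨t, b⟩ i hi m hm
      by_cases hiK : i ∈ K
      · rw [hK i hiK, hp0] at hm
        refine hy t t.2 i hiK (m - (b : ℕ) * z i₀) ?_
        push_cast at hm ⊢
        linarith
      · have hij : i ∈ J := (Finset.mem_union.1 hi).resolve_left hiK
        have hne : i ≠ i₀ := by rintro rfl; exact hiK hi₀
        rw [hp1 t _ i hij hne] at hm
        have h2 : (1 : ℝ) = ((2 * (m - (b : ℕ) * z i) : ℤ) : ℝ) := by
          push_cast at hm ⊢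
          linarith
        have h3 : (1 : ℤ) = 2 * (m - (b : ℕ) * z i) := by exact_mod_cast h2
        omega) (by
      rintro ⟨t, b⟩ ⟨t', b'⟩ ⟨l, hl, hle⟩
      obtain ⟨h1, h2⟩ := key t t.2 t' t'.2 _ _ l hl hle
      have h1 : t = t' := Subtype.ext h1
      subst h1
      congr 1
      fin_cases b <;> fin_cases b' <;> try rfl
      · exact absurd ⟨-l, L.neg_mem hl, fun j hj => by simp [h2 j hj]⟩ hz
      · exact absurd ⟨l, hl, fun j hj => by simp [h2 j hj]⟩ hz)
  rw [mul_comm]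
  simpa using this

/-- For `w ∈ [0, 1)` the floor of `w - δ` depends only on `δ` and on whether `Int.fract δ ≤ w`. -/
theorem floor_sub_eq_of_iff {u u' δ : ℝ} (hu : 0 ≤ u ∧ u < 1) (hu' : 0 ≤ u' ∧ u' < 1)
    (h : Int.fract δ ≤ u ↔ Int.fract δ ≤ u') : ⌊u - δ⌋ = ⌊u' - δ⌋ := by
  have h0 := Int.fract_nonneg δ
  have h1 := Int.fract_lt_one δ
  have key : ∀ w : ℝ, 0 ≤ w ∧ w < 1 →
      ⌊w - δ⌋ = (if Int.fract δ ≤ w then 0 else -1) - ⌊δ⌋ := by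
    intro w hw
    have h2 : w - δ = (w - Int.fract δ) - (⌊δ⌋ : ℤ) := by rw [Int.fract]; ring
    rw [h2, Int.floor_sub_intCast]
    congr 1
    split_ifs with hw' <;> rw [Int.floor_eq_iff] <;> constructor <;> push_cast <;> linarith
  rw [key u hu, key u' hu']
  simp only [h]

/-- A lattice translation matches all floors on `J`; the only remaining invariant is the arc of the
circle containing `a i₀ x`, and there are `|K|` arcs. -/
theorem atMost_of_surjective [DecidableEq ι] {K J : Finset ι} {i₀ : ι}
    (hK : ∀ i ∈ K, a i = a i₀) (hi₀ : i₀ ∈ K) (hi₀J : i₀ ∈ J)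
    (hz : ∀ z : ι → ℤ, ∃ l ∈ L, ∀ j ∈ J, a j l = z j) :
    AtMost L a c K.card (K ∪ J) := by
  classical
  -- `S u` is the set of cuts passed on the way from `c i₀` to `u`. These sets are nested, so the
  -- cardinality determines `S u`; omitting `i₀`, which is always passed, leaves `|K|` possible
  -- values.
  let S : ℝ → Finset ι := fun u => (K.erase i₀).filter fun i => Int.fract (c i - c i₀) ≤ u
  have hS : ∀ u, (S u).card < K.card := fun u =>
    (Finset.card_le_card (Finset.filter_subset _ _)).trans_lt (Finset.card_erase_lt_of_mem hi₀)
  have hmono : ∀ u u', u ≤ u' → S u ⊆ S u' := fun u u' h =>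
    Finset.monotone_filter_right _ fun i _ hi => hi.trans h
  refine ⟨fun x => ⟨(S (Int.fract (a i₀ x - c i₀))).card, hS _⟩, fun x y _ _ hxy => ?_⟩
  have hcard : (S (Int.fract (a i₀ x - c i₀))).card = (S (Int.fract (a i₀ y - c i₀))).card :=
    congrArg Fin.val hxy
  have hSS : S (Int.fract (a i₀ x - c i₀)) = S (Int.fract (a i₀ y - c i₀)) := by
    rcases le_total (Int.fract (a i₀ x - c i₀)) (Int.fract (a i₀ y - c i₀)) with h | h
    · exact Finset.eq_of_subset_of_card_le (hmono _ _ h) hcard.ge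
    · exact (Finset.eq_of_subset_of_card_le (hmono _ _ h) hcard.le).symm
  obtain ⟨l, hl, hlz⟩ := hz fun j => ⌊a j x - c j⌋ - ⌊a j y - c j⌋
  refine ⟨l, hl, fun i hi => ?_⟩
  by_cases hiJ : i ∈ J
  · rw [floor_add_of_integral i (hlz i hiJ)]
    ring
  · have hiK : i ∈ K := (Finset.mem_union.1 hi).resolve_right hiJ
    have hne : i ≠ i₀ := by rintro rfl; exact hiJ hi₀J
    rw [hK i hiK, map_add, hlz i₀ hi₀J]
    have h1 : a i₀ x - c i = (Int.fract (a i₀ x - c i₀) - (c i - c i₀)) + ⌊a i₀ x - c i₀⌋ := by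
      rw [Int.fract]; ring
    have h2 : a i₀ y + ((⌊a i₀ x - c i₀⌋ - ⌊a i₀ y - c i₀⌋ : ℤ) : ℝ) - c i =
        (Int.fract (a i₀ y - c i₀) - (c i - c i₀)) + ⌊a i₀ x - c i₀⌋ := by
      rw [Int.fract]; push_cast; ring
    rw [h1, h2, Int.floor_add_intCast, Int.floor_add_intCast]
    congr 1
    refine floor_sub_eq_of_iff ⟨Int.fract_nonneg _, Int.fract_lt_one _⟩
      ⟨Int.fract_nonneg _, Int.fract_lt_one _⟩ ?_
    have := Finset.ext_iff.1 hSS i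
    simpa [S, hne, hiK] using this

end ParallelClass

section Rank

/-- The dimension of the span of the linear forms `a i`, `i ∈ s`. -/
noncomputable def formRank (a : ι → Dual ℝ V) (s : Finset ι) : ℕ :=
  finrank ℝ (Submodule.span ℝ (a '' s))

theorem exists_basis_mem (hA : IsArrangement L a c) {s : Finset ι} {i₀ : ι} (hi₀ : i₀ ∈ s) :
    ∃ J ⊆ s, i₀ ∈ J ∧ LinearIndepOn ℝ a (J : Set ι) ∧
      a '' s ⊆ Submodule.span ℝ (a '' J) ∧ J.card = formRank a s := by
  classical
  obtain ⟨b, hbs, hib, hsp, hli⟩ := exists_linearIndepOn_extension (K := ℝ) (v := a)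
    (s := {i₀}) (t := (s : Set ι)) (LinearIndepOn.singleton (hA.ne_zero i₀)) (by simpa using hi₀)
  have hfin : b.Finite := s.finite_toSet.subset hbs
  lift b to Finset ι using hfin
  refine ⟨b, by exact_mod_cast hbs, by simpa using hib, hli, hsp, ?_⟩
  have h1 : Submodule.span ℝ (a '' (s : Set ι)) = Submodule.span ℝ (a '' (b : Set ι)) :=
    le_antisymm (Submodule.span_le.2 hsp) (Submodule.span_mono (Set.image_mono hbs))
  have h2 := finrank_span_eq_card (R := ℝ) (b := fun i : (b : Set ι) => a i) hli
  have h3 : Set.range (fun i : (b : Set ι) => a i) = a '' (b : Set ι) := by ext; simp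
  rw [formRank, h1, ← h3, h2]
  simp

/-- A basis has at least one region, and each further hyperplane adds at least one. -/
theorem IsArrangement.atLeast_of_rank (hA : IsArrangement L a c) {s : Finset ι} {i₀ : ι}
    (hi₀ : i₀ ∈ s) : AtLeast L a c (1 + (s.card - formRank a s)) s := by
  classical
  obtain ⟨J, hJs, -, -, hsp, hJ⟩ := exists_basis_mem hA hi₀
  have := AtLeast.add_card_mul hA hJs hsp (hA.atLeast_one J) fun h _ _ => hA.atLeastOn_one J h
  rwa [hJ, one_mul] at this

/-- If two of the hyperplanes are parallel then the number of regions is at least twice the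
corank, or at most the number of hyperplanes. -/
theorem IsArrangement.atLeast_or_atMost_of_parallel (hA : IsArrangement L a c) {s : Finset ι}
    {i₀ i₁ : ι} (h₀ : i₀ ∈ s) (h₁ : i₁ ∈ s) (hne : i₀ ≠ i₁) (hpar : a i₁ = a i₀) :
    AtLeast L a c (2 * (s.card - formRank a s)) s ∨ ∃ k ≤ s.card, AtMost L a c k s := by
  classical
  obtain ⟨J, hJs, hiJ, hJ, hsp, hcard⟩ := exists_basis_mem hA h₀
  let K := s.filter fun i => a i = a i₀
  have hKs : K ⊆ s := Finset.filter_subset _ _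
  have hK : ∀ i ∈ K, a i = a i₀ := fun i hi => (Finset.mem_filter.1 hi).2
  have hiK : i₀ ∈ K := by simp [K, h₀]
  have h2 : 2 ≤ K.card := Finset.one_lt_card.2 ⟨i₀, hiK, i₁, by simp [K, h₁, hpar], hne⟩
  -- An independent set contains only one member of a parallel class, so `|K ∪ J| = |K| + r - 1`,
  -- with `r = |J|` the rank.
  have hKJ : K ∩ J = {i₀} := by
    ext i
    simp only [Finset.mem_inter, Finset.mem_singleton]
    refine ⟨fun h => hJ.injOn h.2 hiJ (hK i h.1), ?_⟩
    rintro rfl; exact ⟨hiK, hiJ⟩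
  have hu := Finset.card_union_add_card_inter K J
  rw [hKJ, Finset.card_singleton] at hu
  have hus : K ∪ J ⊆ s := Finset.union_subset hKs hJs
  have hle := Finset.card_le_card hus
  by_cases hm : (K ∪ J).card = s.card
  · have hs : K ∪ J = s := Finset.eq_of_subset_of_card_le hus hm.ge
    by_cases hz : ∀ z : ι → ℤ, ∃ l ∈ L, ∀ j ∈ J, a j l = z j
    · right
      refine ⟨K.card, Finset.card_le_card hKs, ?_⟩
      have := atMost_of_surjective (c := c) hK hiK hiJ hz
      rwa [hs] at this
    · left
      push Not at hz
      obtain ⟨z, hz⟩ := hz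
      have := hA.atLeast_two_mul hK hiK hiJ hJ (z := z) (by push Not; exact hz)
      rw [hs] at this
      exact this.of_le (by omega)
  · left
    have := AtLeast.add_card_mul hA hus (k := K.card) (m := K.card)
      (hsp.trans (Submodule.span_mono (Set.image_mono (by simp))))
      ((hA.atLeast_class hK).mono hA Finset.subset_union_left) fun h hs hh => by
        refine (hA.atLeastOn_class hK fun h' => hh ?_).mono hA Finset.subset_union_left
        exact Finset.mem_union_left _ (Finset.mem_filter.2 ⟨hs, h'⟩)
    refine this.of_le ?_
    -- With `q ≥ 1` hyperplanes outside `K ∪ J`, the bound `|K| (1 + q) ≥ 2 (|K| - 1 + q)` amounts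
    -- to `(|K| - 2)(q - 1) ≥ 0`; here `k = |K| - 2` and `m = q - 1`.
    obtain ⟨k, hk⟩ := Nat.exists_eq_add_of_le h2
    obtain ⟨m, hm'⟩ := Nat.exists_eq_add_of_lt (lt_of_le_of_ne hle hm)
    rw [show s.card - (K ∪ J).card = m + 1 by omega,
      show s.card - formRank a s = k + 1 + (m + 1) by omega, hk]
    nlinarith [Nat.zero_le (k * m)]

end Rank

end Parallel

/-! ### Pairwise nonparallel hyperplanes, and the dichotomy. -/

section Gap

variable {V : Type*} [AddCommGroup V] [Module ℝ V] {ι : Type*}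
variable {L : AddSubgroup V} {a : ι → Dual ℝ V} {c : ι → ℝ}

section Simple

theorem IsArrangement.atLeastOn_two (hA : IsArrangement L a c) {s : Finset ι} {h : ι} {x y : V}
    (hx : a h x = c h ∧ ∀ i ∈ s, i ≠ h → ∀ z : ℤ, a i x - c i ≠ z)
    (hy : a h y = c h ∧ ∀ i ∈ s, i ≠ h → ∀ z : ℤ, a i y - c i ≠ z)
    (hxy : ∀ l ∈ L, a h l = 0 → ¬ ∀ i ∈ s, i ≠ h → ⌊a i x - c i⌋ = ⌊a i (y + l) - c i⌋) :
    AtLeastOn L a c 2 s h := by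
  refine ⟨![x, y], fun α => by fin_cases α; exacts [hx, hy], ?_⟩
  rintro α β ⟨l, hl, hl0, hle⟩
  fin_cases α <;> fin_cases β <;> try rfl
  · exact absurd hle (hxy l hl hl0)
  · refine absurd (fun i hi hih => ?_) (hxy (-l) (L.neg_mem hl) (by simp [hl0]))
    have := hA.floor_add_congr i (L.neg_mem hl) (hle i hi hih)
    simpa using this.symm

/-- Take two points of the hyperplane `i` on either side of `a j = c j`, at distance 1 in `a j`:
only a lattice vector with `a i l = 0` and `a j l = 1` could identify them. -/
theorem IsArrangement.atLeastOn_two_of_not_exists (hA : IsArrangement L a c) {i j : ι}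
    (hij : a j ≠ a i) (hl : ¬ ∃ l ∈ L, a i l = 0 ∧ a j l = 1) : AtLeastOn L a c 2 {j} i := by
  obtain ⟨x, hx1, hx2⟩ := exists_apply_eq_pair (hA.ne_zero i) (hA.ne_smul hij) (c j + 1 / 2) (c i)
  obtain ⟨y, hy1, hy2⟩ := exists_apply_eq_pair (hA.ne_zero i) (hA.ne_smul hij) (c j - 1 / 2) (c i)
  refine hA.atLeastOn_two (x := x) (y := y) ⟨hx2, ?_⟩ ⟨hy2, ?_⟩ ?_
  · intro k hk _ z hz
    rw [Finset.mem_singleton.1 hk, hx1] at hz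
    have h2 : (1 : ℝ) = ((2 * z : ℤ) : ℝ) := by push_cast; linarith
    have h3 : (1 : ℤ) = 2 * z := by exact_mod_cast h2
    omega
  · intro k hk _ z hz
    rw [Finset.mem_singleton.1 hk, hy1] at hz
    have h2 : (-1 : ℝ) = ((2 * z : ℤ) : ℝ) := by push_cast; linarith
    have h3 : (-1 : ℤ) = 2 * z := by exact_mod_cast h2
    omega
  · intro l hlL hl0 hle
    obtain ⟨z, hz⟩ := hA.integral j l hlL
    have := hle j (by simp) (by rintro rfl; exact hij rfl)
    rw [floor_add_of_integral j hz, hx1, hy1] at this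
    norm_num at this
    refine hl ⟨l, hlL, hl0, ?_⟩
    rw [hz, show z = 1 by omega]; simp

/-- A dependency that survives restriction to the hyperplane `h` cuts it into two pieces. -/
theorem IsArrangement.atLeastOn_two_of_dependent [DecidableEq ι] (hA : IsArrangement L a c)
    {t : Finset ι} {i h : ι} (hih : a i ≠ a h)
    (hspan : a i ∈ Submodule.span ℝ (a '' (insert h t : Finset ι)))
    (ht : ∀ j ∈ t, a j ∉ Submodule.span ℝ {a h, a i}) : AtLeastOn L a c 2 (insert i t) h := by
  obtain ⟨p, hp1, hp2⟩ := exists_apply_eq_pair (hA.ne_zero h) (hA.ne_smul hih) (c i) (c h)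
  obtain ⟨v, hv, hvt⟩ := Module.Dual.exists_forall_mem_ne_zero_of_forall_exists
    (LinearMap.ker (a h) ⊓ LinearMap.ker (a i)) (fun j : t => a j) fun j => by
      obtain ⟨x, hx, hx'⟩ := exists_apply_eq_one a {h, i} (f := a j)
        (by simpa [Set.image_pair] using ht j j.2)
      exact ⟨x, ⟨hx h (by simp), hx i (by simp)⟩, by simp [hx']⟩
  have hvh : a h v = 0 := hv.1
  have hvi : a i v = 0 := hv.2
  obtain ⟨ε, -, hε⟩ := exists_push (c := c) (a := a) t p v
  -- `q` lies on both `h` and `i` but on no hyperplane of `t`, so near `q` inside `h` only `i`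
  -- separates.
  let q := p + ε • v
  have hqh : a h q = c h := by simp [q, hp2, hvh]
  have hqi : a i q = c i := by simp [q, hp1, hvi]
  have hqt : ∀ j ∈ t, ∀ z : ℤ, a j q - c j ≠ z := fun j hj =>
    (hε j hj).2 (Or.inl (hvt ⟨j, hj⟩))
  obtain ⟨w, hw1, hw2⟩ := exists_apply_eq_pair (hA.ne_zero h) (hA.ne_smul hih) 1 0
  obtain ⟨δ, hδ0, hδ⟩ := exists_push (c := c) (a := a) (insert i t) q w
  obtain ⟨δ', hδ'0, hδ'⟩ := exists_push (c := c) (a := a) (insert i t) q (-w)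
  refine hA.atLeastOn_two (x := q + δ • w) (y := q + δ' • (-w)) ⟨by simp [hqh, hw2], ?_⟩
    ⟨by simp [hqh, hw2], ?_⟩ ?_
  · intro j hj _
    rcases Finset.mem_insert.1 hj with rfl | hj'
    · exact (hδ j hj).2 (Or.inl (by simp [hw1]))
    · exact (hδ j hj).2 (Or.inr (hqt j hj'))
  · intro j hj _
    rcases Finset.mem_insert.1 hj with rfl | hj'
    · exact (hδ' j hj).2 (Or.inl (by simp [hw1]))
    · exact (hδ' j hj).2 (Or.inr (hqt j hj'))
  · intro l hl hl0 hle
    -- The floors on `t` agree near `q`, so an identifying `l` is killed by `a h` and all of `t`,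
    -- hence by `a i`, which lies in their span. But the two points lie on opposite sides of `i`.
    have hlt : ∀ j ∈ t, a j l = 0 := by
      intro j hj
      have hjh : j ≠ h := by
        rintro rfl; exact ht j hj (Submodule.subset_span (by simp))
      obtain ⟨z, hz⟩ := hA.integral j l hl
      have hj' : j ∈ insert i t := Finset.mem_insert_of_mem hj
      have := hle j hj' hjh
      rw [floor_add_of_integral j hz, (hδ j hj').1 (Or.inr (hqt j hj)),
        (hδ' j hj').1 (Or.inr (hqt j hj))] at this
      rw [hz, show z = 0 by omega]; simp
    have hli : a i l = 0 := by
      have hker : Submodule.span ℝ (a '' (insert h t : Finset ι)) ≤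
          LinearMap.ker (Dual.eval ℝ V l) := by
        rw [Submodule.span_le]
        rintro _ ⟨j, hj, rfl⟩
        simp only [Finset.coe_insert, Set.mem_insert_iff, Finset.mem_coe] at hj
        rcases hj with rfl | hj
        · simpa using hl0
        · simpa using hlt j hj
      simpa using hker hspan
    have hi' := Finset.mem_insert_self i t
    have := hle i hi' (by rintro rfl; exact hih rfl)
    rw [floor_add_of_integral (z := 0) i (by simpa using hli) (q + δ' • (-w)),
      (hδ i hi').1 (Or.inl (by simp [hw1]))] at this
    have h1 : a i (q + δ' • (-w)) - c i = -δ' := by simp [hqi, hw1]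
    rw [h1, hqi, sub_self, Int.floor_zero, add_zero] at this
    have h2 := Int.floor_le (-δ')
    rw [← this] at h2
    push_cast at h2
    linarith

theorem sum_smul_injective {J : Finset ι} (hJ : LinearIndepOn ℝ a (J : Set ι)) {x y : ι → ℝ}
    (h : ∑ j ∈ J, x j • a j = ∑ j ∈ J, y j • a j) : ∀ j ∈ J, x j = y j := by
  have h0 : ∑ j ∈ J, (x j - y j) • a j = 0 := by
    rw [← sub_eq_zero, ← Finset.sum_sub_distrib] at h
    rw [← h]
    exact Finset.sum_congr rfl fun j _ => sub_smul (x j) (y j) (a j)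
  intro j hj
  exact sub_eq_zero.1 ((linearIndepOn_finset_iff.1 hJ) _ h0 j hj)

theorem sum_single_smul [DecidableEq ι] {J : Finset ι} {j : ι} (hj : j ∈ J) :
    ∑ k ∈ J, (Pi.single j (1 : ℝ) : ι → ℝ) k • a k = a j := by
  rw [Finset.sum_eq_single j]
  · simp
  · intro k _ hkj; simp [hkj]
  · intro h; exact absurd hj h

theorem apply_eq_single [DecidableEq ι] {J : Finset ι} (hJ : LinearIndepOn ℝ a (J : Set ι))
    {x : ι → ℝ} {j : ι} (hj : j ∈ J) (h : ∑ k ∈ J, x k • a k = a j) :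
    ∀ k ∈ J, x k = if k = j then 1 else 0 := by
  intro k hk
  rw [sum_smul_injective hJ (h.trans (sum_single_smul hj).symm) k hk, Pi.single_apply]

theorem exists_coeff {J : Finset ι} {f : Dual ℝ V} (h : f ∈ Submodule.span ℝ (a '' J)) :
    ∃ g : ι → ℝ, f = ∑ j ∈ J, g j • a j := by
  classical
  obtain ⟨w, hw⟩ := Submodule.mem_span_image_finset_iff_exists_fun ℝ |>.1 h
  refine ⟨fun i => if hi : i ∈ J then w ⟨i, hi⟩ else 0, ?_⟩
  rw [← hw, ← Finset.sum_coe_sort J]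
  simp

theorem IsArrangement.exists_two_coeff_ne_zero (hA : IsArrangement L a c) {J : Finset ι}
    {g : ι → ℝ} {i : ι} (hi : ∀ j ∈ J, a i ≠ a j) (hg : a i = ∑ j ∈ J, g j • a j) :
    ∃ j₁ ∈ J, ∃ j₂ ∈ J, j₁ ≠ j₂ ∧ g j₁ ≠ 0 ∧ g j₂ ≠ 0 := by
  obtain ⟨j₁, hj₁, h₁⟩ : ∃ j ∈ J, g j ≠ 0 := by
    by_contra hcon
    push Not at hcon
    exact hA.ne_zero i (hg.trans (Finset.sum_eq_zero fun j hj => by simp [hcon j hj]))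
  by_contra hcon
  push Not at hcon
  refine hA.ne_smul (hi j₁ hj₁) (g j₁) (hg.trans (Finset.sum_eq_single j₁ ?_ ?_))
  · intro j hj hne
    simp [hcon j₁ hj₁ j hj hne.symm h₁]
  · intro h; exact absurd hj₁ h

/-- Restricted to the hyperplane `i`, the form `a j₁` depends on the rest of `J`. With three nonzero
coefficients, no other basis form becomes proportional to it, so `atLeastOn_two_of_dependent`
applies. -/
theorem IsArrangement.atLeastOn_two_of_three_coeff [DecidableEq ι] (hA : IsArrangement L a c)
    {J : Finset ι} (hJ : LinearIndepOn ℝ a (J : Set ι)) {g : ι → ℝ} {i j₁ j₂ j₃ : ι}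
    (hi : ∀ j ∈ J, a i ≠ a j) (hg : a i = ∑ j ∈ J, g j • a j)
    (h₁ : j₁ ∈ J) (h₂ : j₂ ∈ J) (h₃ : j₃ ∈ J) (h₁₂ : j₁ ≠ j₂) (h₁₃ : j₁ ≠ j₃) (h₂₃ : j₂ ≠ j₃)
    (g₁ : g j₁ ≠ 0) (g₂ : g j₂ ≠ 0) (g₃ : g j₃ ≠ 0) : AtLeastOn L a c 2 J i := by
  have := hA.atLeastOn_two_of_dependent (t := J.erase j₁) (i := j₁) (h := i) (hi j₁ h₁).symm
    (by
      have h1 : a j₁ = (g j₁)⁻¹ • (a i - ∑ j ∈ J.erase j₁, g j • a j) := by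
        rw [hg, ← Finset.add_sum_erase J _ h₁, add_sub_cancel_right, smul_smul,
          inv_mul_cancel₀ g₁, one_smul]
      have h2 : ∀ j ∈ insert i (J.erase j₁),
          a j ∈ Submodule.span ℝ (a '' (insert i (J.erase j₁) : Finset ι)) :=
        fun j hj => Submodule.subset_span ⟨j, hj, rfl⟩
      rw [h1]
      refine Submodule.smul_mem _ _ (Submodule.sub_mem _ (h2 i (by simp))
        (Submodule.sum_mem _ fun j hj => Submodule.smul_mem _ _ (h2 j (by simp_all)))))
    (by
      intro j hj hmem
      obtain ⟨hjne, hjJ⟩ := Finset.mem_erase.1 hj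
      obtain ⟨α, β, hαβ⟩ := Submodule.mem_span_pair.1 hmem
      have hsum : ∑ k ∈ J, (α * g k + β * (Pi.single j₁ (1 : ℝ) : ι → ℝ) k) • a k = a j := by
        simp only [add_smul, mul_smul, Finset.sum_add_distrib, ← Finset.smul_sum,
          sum_single_smul h₁, ← hg]
        exact hαβ
      have hc := apply_eq_single hJ hjJ hsum
      -- One of `j₂`, `j₃` differs from `j`; its coefficient forces `α = 0`.
      obtain ⟨k, hk, hkj, hk1, hgk⟩ : ∃ k ∈ J, k ≠ j ∧ k ≠ j₁ ∧ g k ≠ 0 := by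
        by_cases h : j₂ = j
        · exact ⟨j₃, h₃, fun h' => h₂₃ (h.trans h'.symm), h₁₃.symm, g₃⟩
        · exact ⟨j₂, h₂, h, h₁₂.symm, g₂⟩
      have hα : α = 0 := by
        have := hc k hk
        simpa [hkj, hk1, hgk] using this
      have := hc j hjJ
      simp [hα, hjne] at this)
  rwa [Finset.insert_erase h₁] at this

theorem isUnit_of_cast_mul_eq_one {p q : ℤ} {g : ℝ} (hg : g = p) (h : g * q = 1) :
    p = 1 ∨ p = -1 := by
  rw [hg] at h
  exact Int.isUnit_iff.1 (IsUnit.of_mul_eq_one q (by exact_mod_cast h))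

/-- Of four pairwise nonparallel hyperplanes with linear forms in a plane, one is cut into at least
two pieces by another. -/
theorem IsArrangement.exists_atLeastOn_two_of_plane (hA : IsArrangement L a c) {i j k m : ι}
    {g₁ g₂ h₁ h₂ : ℝ} (hij : a i ≠ a j) (hki : a k ≠ a i) (hkj : a k ≠ a j) (hmi : a m ≠ a i)
    (hmj : a m ≠ a j) (hkm : a k ≠ a m) (hk : a k = g₁ • a i + g₂ • a j)
    (hm : a m = h₁ • a i + h₂ • a j) :
    AtLeastOn L a c 2 {i} j ∨ AtLeastOn L a c 2 {j} i ∨ AtLeastOn L a c 2 {k} i ∨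
      AtLeastOn L a c 2 {k} j ∨ AtLeastOn L a c 2 {m} i ∨ AtLeastOn L a c 2 {m} j ∨
      AtLeastOn L a c 2 {m} k := by
  -- Otherwise each listed pair admits a lattice vector with values 0 and 1. This makes all four
  -- coefficients `±1`, and then the last pair fails by parity: `±x ± y = 0` and `±x ± y = 1` cannot
  -- both hold in integers.
  by_contra hcon
  push Not at hcon
  obtain ⟨n1, n2, n3, n4, n5, n6, n7⟩ := hcon
  have key : ∀ p q, a p ≠ a q → ¬ AtLeastOn L a c 2 {p} q → ∃ l ∈ L, a q l = 0 ∧ a p l = 1 := by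
    intro p q hpq hn
    by_contra hl
    exact hn (hA.atLeastOn_two_of_not_exists hpq hl)
  have hka : ∀ x, a k x = g₁ * a i x + g₂ * a j x := fun x => by simp [hk]
  have hma : ∀ x, a m x = h₁ * a i x + h₂ * a j x := fun x => by simp [hm]
  obtain ⟨l1, hl1, e1, f1⟩ := key _ _ hij n1
  obtain ⟨l2, hl2, e2, f2⟩ := key _ _ hij.symm n2
  obtain ⟨l3, hl3, e3, f3⟩ := key _ _ hki n3
  obtain ⟨l4, hl4, e4, f4⟩ := key _ _ hkj n4
  obtain ⟨l5, hl5, e5, f5⟩ := key _ _ hmi n5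
  obtain ⟨l6, hl6, e6, f6⟩ := key _ _ hmj n6
  obtain ⟨l7, hl7, e7, f7⟩ := key _ _ hkm.symm n7
  obtain ⟨p1, hp1⟩ := hA.integral k l1 hl1
  obtain ⟨p2, hp2⟩ := hA.integral k l2 hl2
  obtain ⟨q1, hq1⟩ := hA.integral m l1 hl1
  obtain ⟨q2, hq2⟩ := hA.integral m l2 hl2
  obtain ⟨w3, hw3⟩ := hA.integral j l3 hl3
  obtain ⟨w4, hw4⟩ := hA.integral i l4 hl4
  obtain ⟨w5, hw5⟩ := hA.integral j l5 hl5
  obtain ⟨w6, hw6⟩ := hA.integral i l6 hl6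
  obtain ⟨x, hx⟩ := hA.integral i l7 hl7
  obtain ⟨y, hy⟩ := hA.integral j l7 hl7
  rw [hka, e1, f1, mul_one, mul_zero, add_zero] at hp1
  rw [hka, e2, f2, mul_one, mul_zero, zero_add] at hp2
  rw [hma, e1, f1, mul_one, mul_zero, add_zero] at hq1
  rw [hma, e2, f2, mul_one, mul_zero, zero_add] at hq2
  rw [hka, e3, mul_zero, zero_add, hw3] at f3
  rw [hka, e4, mul_zero, add_zero, hw4] at f4
  rw [hma, e5, mul_zero, zero_add, hw5] at f5
  rw [hma, e6, mul_zero, add_zero, hw6] at f6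
  rw [hka, hx, hy, hp1, hp2] at e7
  rw [hma, hx, hy, hq1, hq2] at f7
  have e7' : p1 * x + p2 * y = 0 := by exact_mod_cast e7
  have f7' : q1 * x + q2 * y = 1 := by exact_mod_cast f7
  rcases isUnit_of_cast_mul_eq_one hp2 f3 with rfl | rfl <;>
  rcases isUnit_of_cast_mul_eq_one hp1 f4 with rfl | rfl <;>
  rcases isUnit_of_cast_mul_eq_one hq2 f5 with rfl | rfl <;>
  rcases isUnit_of_cast_mul_eq_one hq1 f6 with rfl | rfl <;> omega

/-- Two forms `k`, `m` lie outside a basis `J`. Either `k` involves three basis forms, or it lies in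
the plane of two of them while `m` involves a third and preserves that dependency on restriction, or
all four forms lie in one plane. -/
theorem IsArrangement.exists_atLeastOn_two [DecidableEq ι] (hA : IsArrangement L a c)
    {s : Finset ι} (hs : ∀ i ∈ s, ∀ j ∈ s, a i = a j → i = j)
    (hcard : formRank a s + 1 < s.card) :
    ∃ h ∈ s, a h ∈ Submodule.span ℝ (a '' (s.erase h : Finset ι)) ∧ AtLeastOn L a c 2 s h := by
  obtain ⟨i₀, hi₀⟩ := Finset.card_pos.1 (lt_of_le_of_lt (Nat.zero_le _) hcard)
  obtain ⟨J, hJs, -, hJ, hsp, hJc⟩ := exists_basis_mem hA hi₀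
  obtain ⟨k, hk, m, hm, hkm⟩ := Finset.one_lt_card.1
    (show 1 < (s \ J).card by rw [Finset.card_sdiff_of_subset hJs]; omega)
  obtain ⟨hks, hkJ⟩ := Finset.mem_sdiff.1 hk
  obtain ⟨hms, hmJ⟩ := Finset.mem_sdiff.1 hm
  have hne : ∀ i ∈ s, ∀ j ∈ s, i ≠ j → a i ≠ a j := fun i hi j hj hij h => hij (hs i hi j hj h)
  have hout : ∀ i ∈ s, i ∉ J → ∀ j ∈ J, a i ≠ a j := fun i hi hiJ j hj =>
    hne i hi j (hJs hj) (by rintro rfl; exact hiJ hj)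
  have hncl : ∀ i ∈ s, i ∉ J → a i ∈ Submodule.span ℝ (a '' (s.erase i : Finset ι)) := by
    intro i hi hiJ
    refine Submodule.span_mono (Set.image_mono ?_) (hsp ⟨i, hi, rfl⟩)
    intro j hj
    have : j ≠ i := by rintro rfl; exact hiJ hj
    simp [this, hJs hj]
  obtain ⟨g, hg⟩ := exists_coeff (hsp ⟨k, hks, rfl⟩)
  obtain ⟨f, hf⟩ := exists_coeff (hsp ⟨m, hms, rfl⟩)
  obtain ⟨j₁, hj₁, j₂, hj₂, h₁₂, hg₁, hg₂⟩ := hA.exists_two_coeff_ne_zero (hout k hks hkJ) hg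
  by_cases hg3 : ∃ j₃ ∈ J, j₁ ≠ j₃ ∧ j₂ ≠ j₃ ∧ g j₃ ≠ 0
  · obtain ⟨j₃, hj₃, h₁₃, h₂₃, hg₃⟩ := hg3
    exact ⟨k, hks, hncl k hks hkJ, (hA.atLeastOn_two_of_three_coeff hJ (hout k hks hkJ) hg
      hj₁ hj₂ hj₃ h₁₂ h₁₃ h₂₃ hg₁ hg₂ hg₃).mono hA hJs⟩
  push Not at hg3
  have hk2 : a k = g j₁ • a j₁ + g j₂ • a j₂ := by
    rw [hg, ← Finset.sum_subset (s₁ := {j₁, j₂})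
      (by intro j hj; rcases Finset.mem_insert.1 hj with rfl | hj
          exacts [hj₁, by rw [Finset.mem_singleton.1 hj]; exact hj₂])
      (by intro j hj hj'
          simp only [Finset.mem_insert, Finset.mem_singleton, not_or] at hj'
          rw [hg3 j hj (Ne.symm hj'.1) (Ne.symm hj'.2), zero_smul]), Finset.sum_pair h₁₂]
  -- If `m` leaves the plane of `j₁`, `j₂`, restricting to `m` keeps the relation among `k`, `j₁`,
  -- `j₂` and makes neither `j₁` nor `j₂` proportional to `k`.
  by_cases hf3 : ∃ j₃ ∈ J, j₁ ≠ j₃ ∧ j₂ ≠ j₃ ∧ f j₃ ≠ 0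
  · obtain ⟨j₃, hj₃, h₁₃, h₂₃, hf₃⟩ := hf3
    refine ⟨m, hms, hncl m hms hmJ, AtLeastOn.mono hA (t := insert k {j₁, j₂}) ?_
      (hA.atLeastOn_two_of_dependent (hne k hks m hms hkm) ?_ ?_)⟩
    · intro j hj
      simp only [Finset.mem_insert, Finset.mem_singleton] at hj
      rcases hj with rfl | rfl | rfl
      exacts [hks, hJs hj₁, hJs hj₂]
    · rw [hk2]
      exact Submodule.add_mem _
        (Submodule.smul_mem _ _ (Submodule.subset_span ⟨j₁, by simp, rfl⟩))
        (Submodule.smul_mem _ _ (Submodule.subset_span ⟨j₂, by simp, rfl⟩))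
    · intro j hj hmem
      have hj' : j ∈ J ∧ j ≠ j₃ := by
        simp only [Finset.mem_insert, Finset.mem_singleton] at hj
        rcases hj with rfl | rfl
        exacts [⟨hj₁, h₁₃⟩, ⟨hj₂, h₂₃⟩]
      obtain ⟨α, β, hαβ⟩ := Submodule.mem_span_pair.1 hmem
      have hsum : ∑ l ∈ J, (α * f l + β * g l) • a l = a j := by
        simp only [add_smul, mul_smul, Finset.sum_add_distrib, ← Finset.smul_sum, ← hg, ← hf]
        exact hαβ
      have hα : α = 0 := by
        have := apply_eq_single hJ hj'.1 hsum j₃ hj₃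
        simpa [hg3 j₃ hj₃ h₁₃ h₂₃, hf₃, hj'.2.symm] using this
      rw [hα, zero_smul, zero_add] at hαβ
      exact hA.ne_smul (hout k hks hkJ j hj'.1).symm β hαβ.symm
  push Not at hf3
  have hm2 : a m = f j₁ • a j₁ + f j₂ • a j₂ := by
    rw [hf, ← Finset.sum_subset (s₁ := {j₁, j₂})
      (by intro j hj; rcases Finset.mem_insert.1 hj with rfl | hj
          exacts [hj₁, by rw [Finset.mem_singleton.1 hj]; exact hj₂])
      (by intro j hj hj'
          simp only [Finset.mem_insert, Finset.mem_singleton, not_or] at hj'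
          rw [hf3 j hj (Ne.symm hj'.1) (Ne.symm hj'.2), zero_smul]), Finset.sum_pair h₁₂]
  have hj₁k : j₁ ≠ k := by rintro rfl; exact hkJ hj₁
  have hj₂k : j₂ ≠ k := by rintro rfl; exact hkJ hj₂
  have hsub : ∀ i j, i ∈ s → i ≠ j → a i ∈ Submodule.span ℝ (a '' (s.erase j : Finset ι)) :=
    fun i j hi hij => Submodule.subset_span ⟨i, by simp [hi, hij], rfl⟩
  have hc₁ : a j₁ ∈ Submodule.span ℝ (a '' (s.erase j₁ : Finset ι)) := by
    have : a j₁ = (g j₁)⁻¹ • (a k - g j₂ • a j₂) := by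
      rw [hk2, add_sub_cancel_right, smul_smul, inv_mul_cancel₀ hg₁, one_smul]
    nth_rw 1 [this]
    exact Submodule.smul_mem _ _ (Submodule.sub_mem _ (hsub _ _ hks hj₁k.symm)
      (Submodule.smul_mem _ _ (hsub _ _ (hJs hj₂) h₁₂.symm)))
  have hc₂ : a j₂ ∈ Submodule.span ℝ (a '' (s.erase j₂ : Finset ι)) := by
    have : a j₂ = (g j₂)⁻¹ • (a k - g j₁ • a j₁) := by
      rw [hk2, add_sub_cancel_left, smul_smul, inv_mul_cancel₀ hg₂, one_smul]
    nth_rw 1 [this]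
    exact Submodule.smul_mem _ _ (Submodule.sub_mem _ (hsub _ _ hks hj₂k.symm)
      (Submodule.smul_mem _ _ (hsub _ _ (hJs hj₁) h₁₂)))
  have hfin : ∀ i j, i ∈ s → j ∈ s → a j ∈ Submodule.span ℝ (a '' (s.erase j : Finset ι)) →
      AtLeastOn L a c 2 {i} j →
      ∃ h ∈ s, a h ∈ Submodule.span ℝ (a '' (s.erase h : Finset ι)) ∧ AtLeastOn L a c 2 s h :=
    fun i j hi hj hc h => ⟨j, hj, hc, h.mono hA (by simpa using hi)⟩
  rcases hA.exists_atLeastOn_two_of_plane (hne _ (hJs hj₁) _ (hJs hj₂) h₁₂)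
    (hout k hks hkJ _ hj₁) (hout k hks hkJ _ hj₂) (hout m hms hmJ _ hj₁) (hout m hms hmJ _ hj₂)
    (hne k hks m hms hkm) hk2 hm2 with h | h | h | h | h | h | h
  · exact hfin _ _ (hJs hj₁) (hJs hj₂) hc₂ h
  · exact hfin _ _ (hJs hj₂) (hJs hj₁) hc₁ h
  · exact hfin _ _ hks (hJs hj₁) hc₁ h
  · exact hfin _ _ hks (hJs hj₂) hc₂ h
  · exact hfin _ _ hms (hJs hj₁) hc₁ h
  · exact hfin _ _ hms (hJs hj₂) hc₂ h
  · exact hfin _ _ hms hks (hncl k hks hkJ) h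

/-- Delete a dependent hyperplane cut into two pieces: the rank stays, the corank drops by one, and
two regions are lost at least. At corank at most 1, `atLeast_of_rank` suffices. -/
theorem IsArrangement.atLeast_of_pairwise [DecidableEq ι] (hA : IsArrangement L a c) (n : ℕ) :
    ∀ s : Finset ι, s.card = n → s.Nonempty → (∀ i ∈ s, ∀ j ∈ s, a i = a j → i = j) →
      AtLeast L a c (2 * (s.card - formRank a s)) s := by
  induction n with
  | zero => 
    intro s hs hne
    exact absurd hs hne.card_pos.ne'
  | succ n ih =>
    intro s hs ⟨i₀, hi₀⟩ hinj
    by_cases hr : formRank a s + 1 < s.card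
    · obtain ⟨h, hhs, hspan, h2⟩ := hA.exists_atLeastOn_two hinj hr
      have hcard : (s.erase h).card = n := by rw [Finset.card_erase_of_mem hhs, hs]; rfl
      have hrank : formRank a (s.erase h) = formRank a s := by
        suffices h : Submodule.span ℝ (a '' (s.erase h : Finset ι)) =
            Submodule.span ℝ (a '' (s : Set ι)) by rw [formRank, formRank, h]
        refine le_antisymm (Submodule.span_mono (Set.image_mono (by simp))) ?_
        rw [Submodule.span_le]
        rintro _ ⟨i, hi, rfl⟩
        by_cases hih : i = h
        · rw [hih]; exact hspan
        · exact Submodule.subset_span ⟨i, by simpa [hih] using hi, rfl⟩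
      have := ih (s.erase h) hcard (Finset.card_pos.1 (by omega))
        (fun i hi j hj => hinj i (Finset.mem_of_mem_erase hi) j (Finset.mem_of_mem_erase hj))
      have := AtLeast.insert hA (Finset.notMem_erase h s) hspan this
        (m := 2) (by
          obtain ⟨p, hp, hp'⟩ := h2
          refine ⟨p, fun α => ⟨(hp α).1, fun i hi => (hp α).2 i (Finset.mem_of_mem_erase hi)⟩,
            fun α β ⟨l, hl, hl0, hle⟩ => hp' α β ⟨l, hl, hl0, fun i hi hih => ?_⟩⟩
          exact hle i (Finset.mem_erase.2 ⟨hih, hi⟩) hih)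
      rw [Finset.insert_erase hhs, hrank, hcard] at this
      exact this.of_le (by omega)
    · exact (hA.atLeast_of_rank hi₀).of_le (by omega)

/-- The number of regions is at least twice the corank, or at most the number of hyperplanes. -/
theorem IsArrangement.atLeast_or_atMost (hA : IsArrangement L a c) {s : Finset ι}
    (hs : s.Nonempty) :
    AtLeast L a c (2 * (s.card - formRank a s)) s ∨ ∃ k ≤ s.card, AtMost L a c k s := by
  classical
  by_cases h : ∀ i ∈ s, ∀ j ∈ s, a i = a j → i = j
  · exact Or.inl (hA.atLeast_of_pairwise _ s rfl hs h)
  · push Not at h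
    obtain ⟨i, hi, j, hj, hij, hne⟩ := h
    exact hA.atLeast_or_atMost_of_parallel hj hi hne.symm hij

theorem IsArrangement.atMost_one_singleton (hA : IsArrangement L a c) (i : ι) :
    AtMost L a c 1 {i} := by
  classical
  have := atMost_of_surjective (L := L) (c := c) (K := {i}) (J := {i}) (i₀ := i) (a := a)
    (by simp) (by simp) (by simp) fun z => by
      obtain ⟨l, hl, hl1⟩ := hA.primitive i
      exact ⟨z i • l, L.zsmul_mem hl _, by simp [hl1]⟩
  simpa using this

end Simple

end Gap

section Topology

/-! ### Closed subtori as primitive integral forms. -/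

section Subtorus

variable {d : ℕ} (u : Basis (Fin d) ℝ (EuclideanSpace ℝ (Fin d)))

theorem mem_torusLattice_iff {x : EuclideanSpace ℝ (Fin d)} :
    x ∈ torusLattice u ↔ ∀ k, ∃ z : ℤ, (z : ℝ) = u.repr x k := by
  rw [torusLattice, Submodule.mem_toAddSubgroup, u.mem_span_iff_repr_mem ℤ]
  rfl

theorem torusProj_eq_iff {x y : EuclideanSpace ℝ (Fin d)} :
    torusProj u x = torusProj u y ↔ ∃ l ∈ torusLattice u, y = x + l := by
  rw [torusProj, torusProj, QuotientAddGroup.eq]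
  exact ⟨fun h => ⟨_, h, by abel⟩, fun ⟨l, hl, h⟩ => by rwa [h, neg_add_cancel_left]⟩

theorem torusProj_surjective : Function.Surjective (torusProj u) :=
  QuotientAddGroup.mk_surjective

theorem continuous_torusProj : Continuous (torusProj u) := QuotientAddGroup.continuous_mk

theorem isOpenMap_torusProj : IsOpenMap (torusProj u) := QuotientAddGroup.isOpenMap_coe

/-- The linear form with given coefficients in the coordinates of the basis `u`. -/
noncomputable def coordForm (b : Fin d → ℝ) : Dual ℝ (EuclideanSpace ℝ (Fin d)) :=
  ∑ k, b k • u.coord k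

theorem coordForm_apply (b : Fin d → ℝ) (x : EuclideanSpace ℝ (Fin d)) :
    coordForm u b x = ∑ k, b k * u.repr x k := by
  simp [coordForm]

/-- The image in the torus of the hyperplanes `f x - c ∈ ℤ`. -/
def subtorus (f : Dual ℝ (EuclideanSpace ℝ (Fin d))) (c : ℝ) : Set (FlatTorus u) :=
  torusProj u '' {x | ∃ z : ℤ, f x - c = z}

variable {u}

theorem torusProj_mem_subtorus {f : Dual ℝ (EuclideanSpace ℝ (Fin d))} {c : ℝ}
    (hf : ∀ l ∈ torusLattice u, ∃ z : ℤ, f l = z) {x : EuclideanSpace ℝ (Fin d)} :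
    torusProj u x ∈ subtorus u f c ↔ ∃ z : ℤ, f x - c = z := by
  refine ⟨?_, fun h => ⟨x, h, rfl⟩⟩
  rintro ⟨y, ⟨z, hz⟩, hy⟩
  obtain ⟨l, hl, rfl⟩ := (torusProj_eq_iff u).1 hy
  obtain ⟨w, hw⟩ := hf l hl
  exact ⟨z + w, by rw [map_add, hw]; push_cast; linarith⟩

theorem subtorus_neg (f : Dual ℝ (EuclideanSpace ℝ (Fin d))) (c : ℝ) :
    subtorus u (-f) (-c) = subtorus u f c := by
  rw [subtorus, subtorus]
  congr 1
  ext x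
  constructor
  · rintro ⟨z, hz⟩
    refine ⟨-z, ?_⟩
    rw [LinearMap.neg_apply] at hz
    push_cast; linarith
  · rintro ⟨z, hz⟩
    refine ⟨-z, ?_⟩
    rw [LinearMap.neg_apply]
    push_cast; linarith

/-- A lattice vector with `f l = 1` moves the hyperplanes `f x = c + z` onto one another, so one of
them already covers the image. -/
theorem subtorus_eq_image_of_primitive {f : Dual ℝ (EuclideanSpace ℝ (Fin d))} {c : ℝ}
    (hf : ∃ l ∈ torusLattice u, f l = 1) : subtorus u f c = torusProj u '' {x | f x = c} := by
  obtain ⟨l, hl, hl1⟩ := hf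
  apply subset_antisymm
  · rintro _ ⟨x, ⟨z, hz⟩, rfl⟩
    refine ⟨x - z • l, ?_, ?_⟩
    · simp only [Set.mem_ofPred_eq, map_sub, map_zsmul, hl1, zsmul_eq_mul, mul_one]
      linarith
    · rw [torusProj_eq_iff]
      exact ⟨z • l, (torusLattice u).zsmul_mem hl z, by abel⟩
  · rintro _ ⟨x, hx, rfl⟩
    have hx' : f x = c := hx
    exact ⟨x, ⟨0, by simp [hx']⟩, rfl⟩

theorem isCodimOneSubtorus_subtorus {f : Dual ℝ (EuclideanSpace ℝ (Fin d))} (c : ℝ)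
    (hf : ∀ l ∈ torusLattice u, ∃ z : ℤ, f l = z) (hf1 : ∃ l ∈ torusLattice u, f l = 1) :
    IsCodimOneSubtorus u (subtorus u f c) := by
  refine ⟨?_, fun k => f (u k), c, ?_, ?_⟩
  · have hq : IsQuotientMap (torusProj u) :=
      (isOpenMap_torusProj u).isQuotientMap (continuous_torusProj u) (torusProj_surjective u)
    rw [← hq.isClosed_preimage]
    have : torusProj u ⁻¹' subtorus u f c =
        (fun x => f x - c) ⁻¹' Set.range ((↑) : ℤ → ℝ) := by
      ext x
      rw [Set.mem_preimage, torusProj_mem_subtorus hf]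
      simp [eq_comm]
    rw [this]
    exact Int.isClosedEmbedding_coe_real.isClosed_range.preimage
      (f.continuous_of_finiteDimensional.sub continuous_const)
  · intro h
    obtain ⟨l, -, hl⟩ := hf1
    have h0 : f = 0 := u.ext fun k => by simpa using congrFun h k
    simp [h0] at hl
  · rw [subtorus_eq_image_of_primitive hf1]
    congr 1
    ext x
    have : f x = ∑ i, f (u i) * u.repr x i := by
      conv_lhs => rw [← u.sum_repr x, map_sum]
      simp [mul_comm]
    simp [coordHyperplane, this]

/-- The values of the form on `L` make up a countable subgroup `G` of `ℝ`. Closedness of the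
subtorus makes `G` closed, so it is not dense but cyclic; dividing by a generator makes the form
primitive. -/
theorem exists_form_of_isCodimOneSubtorus {S : Set (FlatTorus u)} (hS : IsCodimOneSubtorus u S) :
    ∃ (f : Dual ℝ (EuclideanSpace ℝ (Fin d))) (c : ℝ),
      (∀ l ∈ torusLattice u, ∃ z : ℤ, f l = z) ∧ (∃ l ∈ torusLattice u, f l = 1) ∧
      S = subtorus u f c := by
  obtain ⟨hcl, b, c, hb, rfl⟩ := hS
  obtain ⟨k, hk⟩ : ∃ k, b k ≠ 0 := by
    by_contra hcon
    push Not at hcon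
    exact hb (funext hcon)
  let f := coordForm u b
  have hK : coordHyperplane u b c = {x | f x = c} := by
    ext x; simp [coordHyperplane, f, coordForm_apply]
  have hfu : ∀ k, f (u k) = b k := fun k => by simp [f, coordForm_apply, Finsupp.single_apply]
  let G : AddSubgroup ℝ := (torusLattice u).map f.toAddMonoidHom
  have hG : ∀ t, t ∈ G ↔ ∃ l ∈ torusLattice u, f l = t := fun t => Iff.rfl
  have hkG : b k ∈ G := (hG _).2 ⟨u k, Submodule.subset_span ⟨k, rfl⟩, hfu k⟩
  have hclosed : IsClosed (G : Set ℝ) := by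
    -- The line along `u k` is transverse to the hyperplane and parametrised so that `f = c + t`;
    -- its point at `t` projects into the subtorus exactly when `t ∈ G`.
    have : (G : Set ℝ) = (fun t : ℝ => torusProj u (((c + t) / b k) • u k)) ⁻¹'
        (torusProj u '' coordHyperplane u b c) := by
      ext t
      rw [hK]
      simp only [SetLike.mem_coe, hG, Set.mem_preimage, Set.mem_image, Set.mem_ofPred_eq,
        torusProj_eq_iff]
      constructor
      · rintro ⟨l, hl, rfl⟩
        exact ⟨((c + f l) / b k) • u k - l, by simp [hfu, hk], l, hl, by abel⟩
      · rintro ⟨x, hx, l, hl, h⟩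
        refine ⟨l, hl, ?_⟩
        have := congrArg f h
        simp only [map_smul, hfu, smul_eq_mul, map_add, hx] at this
        rw [div_mul_cancel₀ _ hk] at this
        linarith
    rw [this]
    refine hcl.preimage ((continuous_torusProj u).comp ?_)
    fun_prop
  rcases AddSubgroup.dense_or_cyclic G with hd | ⟨g, hg⟩
  · exfalso
    have huniv : (G : Set ℝ) = Set.univ := hclosed.closure_eq.symm.trans hd.closure_eq
    have hcount : (G : Set ℝ).Countable := by
      refine (Set.countable_range fun z : Fin d → ℤ => ∑ k, b k * (z k : ℝ)).mono ?_
      rintro t ht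
      obtain ⟨l, hl, rfl⟩ := (hG t).1 ht
      choose z hz using (mem_torusLattice_iff u).1 hl
      exact ⟨z, by simp [f, coordForm_apply, hz]⟩
    rw [huniv] at hcount
    exact Cardinal.not_countable_real hcount
  · have hmem : ∀ t, t ∈ G ↔ ∃ z : ℤ, z • g = t := fun t => by
      rw [hg, AddSubgroup.mem_closure_singleton]
    have hg0 : g ≠ 0 := by
      rintro rfl
      obtain ⟨z, hz⟩ := (hmem _).1 hkG
      exact hk (by simpa using hz.symm)
    have hint : ∀ l ∈ torusLattice u, ∃ z : ℤ, (g⁻¹ • f) l = z := by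
      intro l hl
      obtain ⟨z, hz⟩ := (hmem _).1 ((hG _).2 ⟨l, hl, rfl⟩)
      refine ⟨z, ?_⟩
      rw [LinearMap.smul_apply, ← hz, zsmul_eq_mul, smul_eq_mul]
      field_simp
    have hprim : ∃ l ∈ torusLattice u, (g⁻¹ • f) l = 1 := by
      obtain ⟨l, hl, hlg⟩ := (hG _).1 ((hmem g).2 ⟨1, by simp⟩)
      exact ⟨l, hl, by simp [hlg, hg0]⟩
    refine ⟨g⁻¹ • f, g⁻¹ * c, hint, hprim, ?_⟩
    rw [subtorus_eq_image_of_primitive hprim, hK]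
    congr 1
    ext x
    simp [hg0]

theorem exists_isArrangement {ι : Type*} {A : ι → Set (FlatTorus u)} (hinj : Function.Injective A)
    (hA : ∀ i, IsCodimOneSubtorus u (A i)) :
    ∃ (a : ι → Dual ℝ (EuclideanSpace ℝ (Fin d))) (c : ι → ℝ),
      IsArrangement (torusLattice u) a c ∧ ∀ i, A i = subtorus u (a i) (c i) := by
  choose f c hint hprim hS using fun i => exists_form_of_isCodimOneSubtorus (hA i)
  -- Proportional primitive forms agree up to sign, so one representative of each pair `±f` is
  -- fixed.
  let r : Setoid (Dual ℝ (EuclideanSpace ℝ (Fin d))) :=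
    { r := fun f g => f = g ∨ f = -g
      iseqv := ⟨fun _ => Or.inl rfl, by
        rintro f g (rfl | rfl)
        exacts [Or.inl rfl, Or.inr (by simp)], by
        rintro f g h (rfl | rfl) (rfl | rfl)
        exacts [Or.inl rfl, Or.inr rfl, Or.inr rfl, Or.inl (by simp)]⟩ }
  let out : Dual ℝ (EuclideanSpace ℝ (Fin d)) → Dual ℝ (EuclideanSpace ℝ (Fin d)) :=
    fun f => (Quotient.mk r f).out
  have hout : ∀ f, out f = f ∨ out f = -f := fun f => Quotient.exact (Quotient.out_eq (Quotient.mk r f))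
  have hneg : ∀ f, out (-f) = out f := fun f => by
    have : Quotient.mk r (-f) = Quotient.mk r f := Quotient.sound (Or.inr rfl)
    simp only [out, this]
  have hc : ∀ i, ∃ c' : ℝ, A i = subtorus u (out (f i)) c' := by
    intro i
    rcases hout (f i) with h | h
    · exact ⟨c i, by rw [h, hS i]⟩
    · exact ⟨-c i, by rw [h, subtorus_neg, hS i]⟩
  choose c' hc' using hc
  have hint' : ∀ i, ∀ l ∈ torusLattice u, ∃ z : ℤ, out (f i) l = z := by
    intro i l hl
    obtain ⟨z, hz⟩ := hint i l hl
    rcases hout (f i) with h | h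
    · exact ⟨z, by rw [h, hz]⟩
    · exact ⟨-z, by rw [h, LinearMap.neg_apply, hz]; simp⟩
  refine ⟨fun i => out (f i), c', ⟨hint', fun i => ?_, fun i j s hs => ?_, fun i j hij h z hz => ?_⟩,
    hc'⟩
  · obtain ⟨l, hl, hl1⟩ := hprim i
    rcases hout (f i) with h | h
    · exact ⟨l, hl, by rw [h, hl1]⟩
    · exact ⟨-l, (torusLattice u).neg_mem hl, by rw [h]; simp [hl1]⟩
  · obtain ⟨s', hs'⟩ : ∃ s' : ℝ, f i = s' • f j := by
      rcases hout (f i) with h1 | h1 <;> rcases hout (f j) with h2 | h2 <;>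
        simp only [h1, h2] at hs
      · exact ⟨s, hs⟩
      · exact ⟨-s, hs.trans ((smul_neg s (f j)).trans (neg_smul s (f j)).symm)⟩
      · exact ⟨-s, (neg_eq_iff_eq_neg.1 hs).trans (neg_smul s (f j)).symm⟩
      · exact ⟨s, by rw [smul_neg] at hs; exact neg_injective hs⟩
    obtain ⟨l, hl, hl1⟩ := hprim i
    obtain ⟨m, hm, hm1⟩ := hprim j
    obtain ⟨p, hp⟩ := hint j l hl
    obtain ⟨q, hq⟩ := hint i m hm
    rw [hs'] at hl1 hq
    simp only [LinearMap.smul_apply, hp, hm1, smul_eq_mul, mul_one] at hl1 hq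
    rcases isUnit_of_cast_mul_eq_one hq hl1 with rfl | rfl
    · simp only [hs', hq]; simp
    · have hij : f i = -f j := by
        rw [hs', hq]
        push_cast
        exact neg_one_smul ℝ (f j)
      simp only [hij, hneg]
  · apply hij
    apply hinj
    rw [hc' i, hc' j, h, subtorus, subtorus]
    congr 1
    ext x
    constructor
    · rintro ⟨w, hw⟩
      exact ⟨w + z, by push_cast; linarith⟩
    · rintro ⟨w, hw⟩
      exact ⟨w - z, by push_cast; linarith⟩

theorem IsArrangement.subtorus_injective {ι : Type*}
    {a : ι → Dual ℝ (EuclideanSpace ℝ (Fin d))} {c : ι → ℝ}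
    (hA : IsArrangement (torusLattice u) a c) :
    Function.Injective fun i => subtorus u (a i) (c i) := by
  intro i j hij
  by_contra hne
  simp only at hij
  have key : ∀ x, a i x = c i → ∃ z : ℤ, a j x - c j = z := by
    intro x hx
    rw [← torusProj_mem_subtorus (u := u) (hA.integral j), ← hij,
      torusProj_mem_subtorus (hA.integral i)]
    exact ⟨0, by simp [hx]⟩
  by_cases h : a i = a j
  · obtain ⟨l, -, hl⟩ := hA.primitive i
    obtain ⟨z, hz⟩ := key (c i • l) (by simp [hl])
    rw [← h] at hz
    exact hA.distinct i j hne h z (by simpa [hl] using hz)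
  · obtain ⟨x, hx1, hx2⟩ := exists_apply_eq_pair (hA.ne_zero j) (hA.ne_smul h) (c i) (c j + 1 / 2)
    obtain ⟨z, hz⟩ := key x hx1
    rw [hx2] at hz
    have h2 : (1 : ℝ) = ((2 * z : ℤ) : ℝ) := by push_cast; linarith
    have h3 : (1 : ℤ) = 2 * z := by exact_mod_cast h2
    omega

theorem IsArrangement.generic_add {ι : Type*}
    {a : ι → Dual ℝ (EuclideanSpace ℝ (Fin d))} {c : ι → ℝ} (hA : IsArrangement (torusLattice u) a c) {s : Finset ι}
    {x l : EuclideanSpace ℝ (Fin d)} (hl : l ∈ torusLattice u) (hx : Generic a c s x) :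
    Generic a c s (x + l) := by
  intro i hi z hz
  obtain ⟨w, hw⟩ := hA.integral i l hl
  refine hx i hi (z - w) ?_
  rw [map_add, hw] at hz
  push_cast; linarith

end Subtorus

/-! ### Components of the complement are the regions. -/

section Components

variable {d : ℕ} {u : Basis (Fin d) ℝ (EuclideanSpace ℝ (Fin d))} {ι : Type*} [Fintype ι]
  {a : ι → Dual ℝ (EuclideanSpace ℝ (Fin d))} {c : ι → ℝ}

theorem eventually_floor_eq {x : EuclideanSpace ℝ (Fin d)} (hx : Generic a c Finset.univ x) :
    ∀ᶠ y in 𝓝 x, Generic a c Finset.univ y ∧ ∀ i, ⌊a i y - c i⌋ = ⌊a i x - c i⌋ := by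
  have h : ∀ᶠ y in 𝓝 x, ∀ i, ⌊a i y - c i⌋ = ⌊a i x - c i⌋ ∧ ∀ z : ℤ, a i y - c i ≠ z := by
    rw [Filter.eventually_all]
    intro i
    have hcont : Continuous fun y => a i y - c i :=
      (a i).continuous_of_finiteDimensional.sub continuous_const
    exact (hcont.tendsto x).eventually (floor_eq_of_near (hx i (Finset.mem_univ i)))
  exact h.mono fun y hy => ⟨fun i _ => (hy i).2, fun i => (hy i).1⟩

/-- The complement of the arrangement in the torus. -/
abbrev Complement (u : Basis (Fin d) ℝ (EuclideanSpace ℝ (Fin d)))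
    (a : ι → Dual ℝ (EuclideanSpace ℝ (Fin d))) (c : ι → ℝ) : Type :=
  ↥((⋃ i, subtorus u (a i) (c i))ᶜ)

theorem IsArrangement.torusProj_mem_compl (hA : IsArrangement (torusLattice u) a c)
    {x : EuclideanSpace ℝ (Fin d)} :
    torusProj u x ∈ (⋃ i, subtorus u (a i) (c i))ᶜ ↔ Generic a c Finset.univ x := by
  simp only [Set.mem_compl_iff, Set.mem_iUnion, torusProj_mem_subtorus (hA.integral _), Generic,
    Finset.mem_univ, true_imp_iff, not_exists]

/-- The point of the complement below a generic point. -/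
def IsArrangement.proj (hA : IsArrangement (torusLattice u) a c)
    (x : {x // Generic a c Finset.univ x}) : Complement u a c :=
  ⟨torusProj u x, hA.torusProj_mem_compl.2 x.2⟩

theorem IsArrangement.proj_surjective (hA : IsArrangement (torusLattice u) a c) :
    Function.Surjective hA.proj := by
  rintro ⟨p, hp⟩
  obtain ⟨x, rfl⟩ := torusProj_surjective u p
  exact ⟨⟨x, hA.torusProj_mem_compl.1 hp⟩, rfl⟩

theorem generic_lineMap {x y : EuclideanSpace ℝ (Fin d)} (hx : Generic a c Finset.univ x)
    (hy : Generic a c Finset.univ y) (h : ∀ i, ⌊a i x - c i⌋ = ⌊a i y - c i⌋) {t : ℝ}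
    (ht : t ∈ Set.Icc (0 : ℝ) 1) : Generic a c Finset.univ (x + t • (y - x)) := by
  intro i hi z hz
  have hlt : ∀ w, Generic a c Finset.univ w → (⌊a i w - c i⌋ : ℝ) < a i w - c i :=
    fun w hw => lt_of_le_of_ne (Int.floor_le _) (hw i hi _).symm
  have h1 := hlt x hx
  have h2 := hlt y hy
  have h3 := Int.lt_floor_add_one (a i x - c i)
  have h4 := Int.lt_floor_add_one (a i y - c i)
  rw [← h i] at h2 h4
  have hval : a i (x + t • (y - x)) - c i = (1 - t) * (a i x - c i) + t * (a i y - c i) := by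
    simp; ring
  have hmem : (1 - t) * (a i x - c i) + t * (a i y - c i) ∈
      Set.Ioo (⌊a i x - c i⌋ : ℝ) (⌊a i x - c i⌋ + 1) :=
    (convex_Ioo _ _) ⟨h1, h3⟩ ⟨h2, h4⟩ (by linarith [ht.2]) ht.1 (by ring)
  rw [← hval, hz] at hmem
  have h5 : ⌊a i x - c i⌋ < z := by exact_mod_cast hmem.1
  have h6 : z < ⌊a i x - c i⌋ + 1 := by exact_mod_cast hmem.2
  omega

/-- Floors are locally constant at generic points, so a class and its complement project to disjoint
open sets. Conversely, equal floors are joined by a segment that meets no hyperplane. -/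
theorem IsArrangement.mk_proj_eq_iff (hA : IsArrangement (torusLattice u) a c)
    (x y : {x // Generic a c Finset.univ x}) :
    ConnectedComponents.mk (hA.proj x) = ConnectedComponents.mk (hA.proj y) ↔
      RegionEquiv (torusLattice u) a c Finset.univ (x : EuclideanSpace ℝ (Fin d)) y := by
  constructor
  · intro h
    have hopen : ∀ P : EuclideanSpace ℝ (Fin d) → Prop,
        (∀ v w, RegionEquiv (torusLattice u) a c Finset.univ v w → P v → P w) →
        IsOpen (hA.proj '' {v | P v}) := by
      intro P hP
      have himg : hA.proj '' {v | P v} =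
          Subtype.val ⁻¹' (torusProj u '' {v | Generic a c Finset.univ v ∧ P v}) := by
        ext ⟨p, hp⟩
        constructor
        · rintro ⟨v, hv, h⟩
          exact ⟨v, ⟨v.2, hv⟩, congrArg Subtype.val h⟩
        · rintro ⟨v, ⟨hv, hv'⟩, h⟩
          exact ⟨⟨v, hv⟩, hv', Subtype.ext h⟩
      rw [himg]
      refine (isOpenMap_torusProj u _ ?_).preimage continuous_subtype_val
      rw [isOpen_iff_mem_nhds]
      rintro v ⟨hv, hv'⟩
      filter_upwards [eventually_floor_eq hv] with w hw
      exact ⟨hw.1, hP v w (regionEquiv_of_floor fun i _ => (hw.2 i).symm) hv'⟩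
    let U := hA.proj '' {v | RegionEquiv (torusLattice u) a c Finset.univ
      (x : EuclideanSpace ℝ (Fin d)) v}
    let U' := hA.proj '' {v | ¬ RegionEquiv (torusLattice u) a c Finset.univ
      (x : EuclideanSpace ℝ (Fin d)) v}
    have hU : IsOpen U := hopen (RegionEquiv (torusLattice u) a c Finset.univ x)
      fun v w hvw h => hA.regionEquiv_trans h hvw
    have hU' : IsOpen U' := hopen (fun v => ¬ RegionEquiv (torusLattice u) a c Finset.univ x v)
      fun v w hvw h h' => h (hA.regionEquiv_trans h' (hA.regionEquiv_symm hvw))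
    have hdisj : ∀ v w : {x // Generic a c Finset.univ x}, hA.proj v = hA.proj w →
        RegionEquiv (torusLattice u) a c Finset.univ (v : EuclideanSpace ℝ (Fin d)) w := by
      intro v w hvw
      obtain ⟨l, hl, hlw⟩ := (torusProj_eq_iff u).1 (congrArg Subtype.val hvw)
      exact ⟨-l, (torusLattice u).neg_mem hl, fun i _ => by rw [hlw]; simp⟩
    have hcompl : Uᶜ = U' := by
      ext p
      obtain ⟨v, rfl⟩ := hA.proj_surjective p
      constructor
      · intro hp
        exact ⟨v, fun h => hp ⟨v, h, rfl⟩, rfl⟩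
      · rintro ⟨w, hw, hwv⟩ ⟨w', hw', hwv'⟩
        exact hw (hA.regionEquiv_trans hw' (hdisj _ _ (hwv'.trans hwv.symm)))
    have hclopen : IsClopen U := ⟨⟨hcompl ▸ hU'⟩, hU⟩
    have hx : hA.proj x ∈ U := ⟨x, regionEquiv_of_floor fun _ _ => rfl, rfl⟩
    have hy : hA.proj y ∈ U := hclopen.connectedComponent_subset hx
      (ConnectedComponents.coe_eq_coe'.1 h.symm)
    obtain ⟨w, hw, hwy⟩ := hy
    exact hA.regionEquiv_trans hw (hdisj _ _ hwy)
  · rintro ⟨l, hl, hle⟩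
    have hy := hA.generic_add hl y.2
    let γ : unitInterval → Complement u a c := fun t =>
      hA.proj ⟨x + (t : ℝ) • (y + l - x),
        generic_lineMap x.2 hy (fun i => hle i (Finset.mem_univ i)) t.2⟩
    have hγ : Continuous γ := by
      refine Continuous.subtype_mk ((continuous_torusProj u).comp ?_) _
      fun_prop
    have h0 : γ 0 = hA.proj x := by
      apply Subtype.ext; simp [γ, IsArrangement.proj]
    have h1 : γ 1 = hA.proj y := by
      apply Subtype.ext
      simp only [γ, IsArrangement.proj]
      rw [eq_comm, torusProj_eq_iff]
      exact ⟨l, hl, by simp⟩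
    rw [eq_comm, ConnectedComponents.coe_eq_coe']
    exact (isPreconnected_range hγ).subset_connectedComponent ⟨0, h0⟩ ⟨1, h1⟩

theorem IsArrangement.le_card (hA : IsArrangement (torusLattice u) a c) {k : ℕ}
    (hk : AtLeast (torusLattice u) a c k Finset.univ) :
    (k : ℕ∞) ≤ ENat.card (ConnectedComponents (Complement u a c)) := by
  obtain ⟨p, hp, hp'⟩ := hk
  have := ENat.card_le_card_of_injective
    (f := fun α : Fin k => ConnectedComponents.mk (hA.proj ⟨p α, hp α⟩))
    fun α β h => hp' α β ((hA.mk_proj_eq_iff _ _).1 h)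
  simpa using this

theorem IsArrangement.mk_proj_surjective (hA : IsArrangement (torusLattice u) a c) :
    Function.Surjective fun x => ConnectedComponents.mk (hA.proj x) :=
  ConnectedComponents.surjective_coe.comp hA.proj_surjective

theorem IsArrangement.card_le (hA : IsArrangement (torusLattice u) a c) {k : ℕ}
    (hk : AtMost (torusLattice u) a c k Finset.univ) :
    ENat.card (ConnectedComponents (Complement u a c)) ≤ k := by
  obtain ⟨F, hF⟩ := hk
  choose R hR using hA.mk_proj_surjective
  have := ENat.card_le_card_of_injective
    (f := fun κ => F (R κ).1) fun κ κ' h => by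
      have h1 := hF _ _ (R κ).2 (R κ').2 h
      rw [← hA.mk_proj_eq_iff] at h1
      exact (hR κ).symm.trans (h1.trans (hR κ'))
  simpa using this

theorem IsArrangement.card_eq (hA : IsArrangement (torusLattice u) a c) {k : ℕ}
    (F : EuclideanSpace ℝ (Fin d) → ℕ) (hlt : ∀ x, Generic a c Finset.univ x → F x < k)
    (hsurj : ∀ j < k, ∃ x, Generic a c Finset.univ x ∧ F x = j)
    (hF : ∀ x y, Generic a c Finset.univ x → Generic a c Finset.univ y →
      (F x = F y ↔ RegionEquiv (torusLattice u) a c Finset.univ x y)) :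
    ENat.card (ConnectedComponents (Complement u a c)) = k := by
  choose R hR using hA.mk_proj_surjective
  have hbij : Function.Bijective fun κ : ConnectedComponents (Complement u a c) =>
      (⟨F (R κ).1, hlt _ (R κ).2⟩ : Fin k) := by
    constructor
    · intro κ κ' h
      have h1 := (hF _ _ (R κ).2 (R κ').2).1
        (congrArg Fin.val h)
      rw [← hA.mk_proj_eq_iff] at h1
      exact (hR κ).symm.trans (h1.trans (hR κ'))
    · rintro ⟨j, hj⟩
      obtain ⟨x, hx, rfl⟩ := hsurj j hj
      refine ⟨ConnectedComponents.mk (hA.proj ⟨x, hx⟩), Fin.ext ?_⟩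
      refine (hF _ _ (R _).2 hx).2 ?_
      have := hR (ConnectedComponents.mk (hA.proj ⟨x, hx⟩))
      exact (hA.mk_proj_eq_iff _ ⟨x, hx⟩).1 this
  rw [ENat.card_congr (Equiv.ofBijective _ hbij)]
  simp

/-- Every point can be translated into the bounded fundamental domain, where only finitely many
floor vectors occur. -/
theorem IsArrangement.finite_components (hA : IsArrangement (torusLattice u) a c) :
    Finite (ConnectedComponents (Complement u a c)) := by
  have hbd : ∀ i, ∃ M : ℝ, ∀ x, |a i (ZSpan.fract u x) - c i| ≤ M := by
    intro i
    obtain ⟨C, hC⟩ := (ZSpan.fundamentalDomain_isBounded u).exists_norm_le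
    refine ⟨‖LinearMap.toContinuousLinearMap (a i)‖ * C + |c i|, fun x => ?_⟩
    refine (abs_sub _ _).trans (add_le_add_left ?_ _)
    have h1 := (LinearMap.toContinuousLinearMap (a i)).le_opNorm (ZSpan.fract u x)
    have h2 := hC _ (ZSpan.fract_mem_fundamentalDomain u x)
    exact h1.trans (mul_le_mul_of_nonneg_left h2 (norm_nonneg _))
  choose M hM using hbd
  let F : EuclideanSpace ℝ (Fin d) → ι → ℤ := fun x i => ⌊a i (ZSpan.fract u x) - c i⌋
  have hfin : (Set.range F).Finite := by
    refine (Set.Finite.pi' fun i => Set.finite_Icc ⌊-M i⌋ ⌊M i⌋).subset ?_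
    rintro _ ⟨x, rfl⟩ i
    have := abs_le.1 (hM i x)
    exact ⟨Int.floor_le_floor this.1, Int.floor_le_floor this.2⟩
  choose R hR using hA.mk_proj_surjective
  have : Finite (Set.range F) := hfin
  refine Finite.of_injective (β := Set.range F)
    (fun κ => ⟨F (R κ).1, _, rfl⟩) fun κ κ' h => ?_
  have h1 : F (R κ).1 = F (R κ').1 := congrArg Subtype.val h
  have hfr : ∀ x, RegionEquiv (torusLattice u) a c Finset.univ x (ZSpan.fract u x) := by
    intro x
    refine ⟨x - ZSpan.fract u x, ?_, fun i _ => by simp⟩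
    have : x - ZSpan.fract u x = (ZSpan.floor u x : EuclideanSpace ℝ (Fin d)) := by
      rw [ZSpan.fract_apply]; abel
    rw [this]
    exact (ZSpan.floor u x).2
  have h2 := hA.regionEquiv_trans (hfr (R κ).1)
    (hA.regionEquiv_trans (regionEquiv_of_floor fun i _ => congrFun h1 i)
      (hA.regionEquiv_symm (hfr (R κ').1)))
  rw [← hA.mk_proj_eq_iff] at h2
  exact (hR κ).symm.trans (h2.trans (hR κ'))

theorem formRank_le {ι : Type*} {a : ι → Dual ℝ (EuclideanSpace ℝ (Fin d))} (s : Finset ι) : formRank a s ≤ d := by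
  have h1 := Submodule.finrank_le (Submodule.span ℝ (a '' (s : Set ι)))
  rwa [Subspace.dual_finrank_eq, finrank_euclideanSpace_fin] at h1

end Components

end Topology

section Examples

variable {d : ℕ} {u : Basis (Fin d) ℝ (EuclideanSpace ℝ (Fin d))}

section ComponentNumbers

/-- The region bounds with the rank replaced by its upper bound `d`. For `n ≤ d` the truncated `n -
d` is 0, and only `1 ≤ N` remains of the lower bound. -/
theorem bounds_of_mem_componentNumbers {n : ℕ} (hn : 1 ≤ n) {f : ℕ∞}
    (hf : f ∈ componentNumbers u n) :
    ∃ N : ℕ, f = N ∧ 1 + (n - d) ≤ N ∧ (2 * (n - d) ≤ N ∨ N ≤ n) := by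
  obtain ⟨A, hinj, hcod, rfl⟩ := hf
  obtain ⟨a, c, hA, hAc⟩ := exists_isArrangement hinj hcod
  obtain rfl : A = fun i => subtorus u (a i) (c i) := funext hAc
  have hfin := hA.finite_components
  have hcard : numComplementComponents (fun i => subtorus u (a i) (c i)) =
      (Nat.card (ConnectedComponents (Complement u a c)) : ℕ∞) :=
    ENat.card_eq_coe_natCard (ConnectedComponents (Complement u a c))
  have hN : ENat.card (ConnectedComponents (Complement u a c)) =
      (Nat.card (ConnectedComponents (Complement u a c)) : ℕ∞) := hcard
  have hne : (Finset.univ : Finset (Fin n)).Nonempty := ⟨⟨0, hn⟩, Finset.mem_univ _⟩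
  have hle : ∀ k, AtLeast (torusLattice u) a c k Finset.univ →
      k ≤ Nat.card (ConnectedComponents (Complement u a c)) := fun k hk => by
    have := hA.le_card hk
    rw [hN] at this
    exact_mod_cast this
  have hrank := formRank_le (a := a) Finset.univ
  refine ⟨_, hcard, ?_, ?_⟩
  · have := hle _ (hA.atLeast_of_rank (Finset.mem_univ ⟨0, hn⟩))
    rw [Finset.card_univ, Fintype.card_fin] at this
    omega
  · rcases hA.atLeast_or_atMost hne with h | ⟨k, hk, h⟩
    · left
      have := hle _ h
      rw [Finset.card_univ, Fintype.card_fin] at this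
      omega
    · right
      have := hA.card_le h
      rw [hN] at this
      rw [Finset.card_univ, Fintype.card_fin] at hk
      have : Nat.card (ConnectedComponents (Complement u a c)) ≤ k := by exact_mod_cast this
      omega

theorem mem_componentNumbers {ι : Type*} [Fintype ι]
    {a : ι → Dual ℝ (EuclideanSpace ℝ (Fin d))} {c : ι → ℝ} {n l : ℕ}
    (hA : IsArrangement (torusLattice u) a c) (hn : Fintype.card ι = n)
    (h : ENat.card (ConnectedComponents (Complement u a c)) = l) :
    (l : ℕ∞) ∈ componentNumbers u n := by
  let e := (Fintype.equivFinOfCardEq hn).symm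
  refine ⟨fun i => subtorus u (a (e i)) (c (e i)), hA.subtorus_injective.comp e.injective,
    fun i => isCodimOneSubtorus_subtorus _ (hA.integral _) (hA.primitive _), ?_⟩
  rw [← h, numComplementComponents, e.surjective.iUnion_comp fun i => subtorus u (a i) (c i)]

end ComponentNumbers

section Points

/-- The point with given coordinates. -/
noncomputable def point (u : Basis (Fin d) ℝ (EuclideanSpace ℝ (Fin d))) (y : Fin d → ℝ) :
    EuclideanSpace ℝ (Fin d) := u.equivFun.symm y

@[simp]
theorem repr_point (y : Fin d → ℝ) (k : Fin d) : u.repr (point u y) k = y k := by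
  rw [← Basis.equivFun_apply]
  exact congrFun (u.equivFun.apply_symm_apply y) k

theorem point_mem (z : Fin d → ℤ) : point u (fun k => (z k : ℝ)) ∈ torusLattice u :=
  (mem_torusLattice_iff u).2 fun k => ⟨z k, by simp⟩

theorem ne_int_of_mem_Ioo {t : ℝ} {w : ℤ} (h : t ∈ Set.Ioo (w : ℝ) (w + 1)) (z : ℤ) : t ≠ z := by
  rintro rfl
  have h1 : w < z := by exact_mod_cast h.1
  have h2 : z < w + 1 := by exact_mod_cast h.2
  omega

end Points

/-! ### Coordinate hyperplanes, several of them parallel. -/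

section Grid

/-- Coordinate forms: `m` copies of the coordinate `o` and one of each coordinate in `Q`. -/
noncomputable def gridForm (u : Basis (Fin d) ℝ (EuclideanSpace ℝ (Fin d))) (m : ℕ) (o : Fin d)
    (Q : Finset (Fin d)) : Fin m ⊕ Q → Dual ℝ (EuclideanSpace ℝ (Fin d)) :=
  Sum.elim (fun _ => u.coord o) (fun q => u.coord q)

/-- The offsets `i / M` of the parallel hyperplanes. -/
noncomputable def gridOffset (m M : ℕ) (Q : Finset (Fin d)) : Fin m ⊕ Q → ℝ :=
  Sum.elim (fun i => ((i : ℕ) : ℝ) / M) (fun _ => 0)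

theorem coord_proportional {p q : Fin d} {r : ℝ} (h : u.coord p = r • u.coord q) : p = q := by
  by_contra hne
  have := LinearMap.congr_fun h (u p)
  simp [hne] at this

theorem isArrangement_grid {m M : ℕ} (hmM : m ≤ M) {o : Fin d} {Q : Finset (Fin d)} (hoQ : o ∉ Q) :
    IsArrangement (torusLattice u) (gridForm u m o Q) (gridOffset m M Q) := by
  have hcoord : ∀ i, ∃ k, gridForm u m o Q i = u.coord k := by
    rintro (i | q)
    exacts [⟨o, rfl⟩, ⟨q, rfl⟩]
  refine ⟨fun i l hl => ?_, fun i => ?_, fun i j r h => ?_, fun i j hij h z hz => ?_⟩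
  · obtain ⟨k, hk⟩ := hcoord i
    obtain ⟨z, hz⟩ := (mem_torusLattice_iff u).1 hl k
    exact ⟨z, by rw [hk, hz]; rfl⟩
  · obtain ⟨k, hk⟩ := hcoord i
    exact ⟨u k, Submodule.subset_span ⟨k, rfl⟩, by simp [hk]⟩
  · obtain ⟨k, hk⟩ := hcoord i
    obtain ⟨k', hk'⟩ := hcoord j
    rw [hk, hk'] at h ⊢
    rw [coord_proportional h]
  · have hco : ∀ {p q : Fin d}, u.coord p = u.coord q → p = q := fun {p q} h =>
      coord_proportional (r := 1) (h.trans (one_smul ℝ (u.coord q)).symm)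
    rcases i with i | q <;> rcases j with j | q'
    · have hM : (0 : ℝ) < M := by
        have := i.2
        exact_mod_cast (show 0 < M by omega)
      simp only [gridOffset, Sum.elim_inl] at hz
      have h1 : ((i : ℕ) : ℝ) - (j : ℕ) = z * M := by
        field_simp at hz
        linarith
      have h2 : ((i : ℕ) : ℤ) - (j : ℕ) = z * M := by exact_mod_cast h1
      have hi : ((i : ℕ) : ℤ) < M := by have := i.2; omega
      have hj : ((j : ℕ) : ℤ) < M := by have := j.2; omega
      have hz0 : z = 0 := by
        have h3 : z < 1 := by nlinarith
        have h4 : -1 < z := by nlinarith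
        omega
      rw [hz0, zero_mul] at h2
      exact hij (congrArg Sum.inl (Fin.ext (by omega)))
    · exact hoQ (hco h ▸ q'.2)
    · exact hoQ (hco h.symm ▸ q.2)
    · exact hij (congrArg Sum.inr (Subtype.ext (hco h)))

/-- The index of the strip between the parallel hyperplanes. -/
noncomputable def strip (m M : ℕ) (t : ℝ) : ℕ := min ⌊M * t⌋₊ (m - 1)

/-- The cap `m - 1` in `strip` is there because the last strip runs from `(m - 1) / M` all the way
to 1. -/
theorem le_strip_iff {m M : ℕ} (hM : 0 < M) {t : ℝ} (ht : 0 ≤ t) {i : ℕ} (hi : i < m) :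
    i ≤ strip m M t ↔ (i : ℝ) / M ≤ t := by
  have hM' : (0 : ℝ) < M := by exact_mod_cast hM
  rw [strip, le_min_iff, Nat.le_floor_iff (by positivity), div_le_iff₀' hM']
  exact and_iff_left (by omega)

theorem strip_eq_iff {m M : ℕ} (hm : 0 < m) (hmM : m ≤ M) {t t' : ℝ} (ht : 0 ≤ t ∧ t < 1)
    (ht' : 0 ≤ t' ∧ t' < 1) :
    strip m M t = strip m M t' ↔
      ∀ i : Fin m, ⌊t - ((i : ℕ) : ℝ) / M⌋ = ⌊t' - ((i : ℕ) : ℝ) / M⌋ := by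
  have hM : 0 < M := by omega
  have hM' : (0 : ℝ) < M := by exact_mod_cast hM
  constructor
  · intro h i
    refine floor_sub_eq_of_iff ht ht' ?_
    have hi : Int.fract (((i : ℕ) : ℝ) / M) = ((i : ℕ) : ℝ) / M := by
      rw [Int.fract_eq_self]
      refine ⟨by positivity, ?_⟩
      rw [div_lt_one hM']
      exact_mod_cast (show (i : ℕ) < M by have := i.2; omega)
    rw [hi, ← le_strip_iff hM ht.1 i.2, ← le_strip_iff hM ht'.1 i.2, h]
  · intro h
    have key : ∀ t t' : ℝ, 0 ≤ t → 0 ≤ t' →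
        (∀ i : Fin m, ⌊t - ((i : ℕ) : ℝ) / M⌋ = ⌊t' - ((i : ℕ) : ℝ) / M⌋) →
        strip m M t ≤ strip m M t' := by
      intro t t' ht ht' h
      have hlt : strip m M t < m := (min_le_right _ _).trans_lt (by omega)
      have h1 := (le_strip_iff hM ht hlt).1 le_rfl
      rw [le_strip_iff hM ht' hlt, ← sub_nonneg, ← Int.floor_nonneg, ← h ⟨_, hlt⟩,
        Int.floor_nonneg, sub_nonneg]
      exact h1
    exact le_antisymm (key t t' ht.1 ht'.1 h) (key t' t ht'.1 ht.1 fun i => (h i).symm)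

/-- The hyperplane of offset 0 in direction `o` and those of `Q` prescribe the integer coordinates
of `l`; the other parallels then compare only the strips. -/
theorem grid_floor_iff {m M : ℕ} (hm : 0 < m) (hmM : m ≤ M) {o : Fin d} {Q : Finset (Fin d)}
    {x y l : EuclideanSpace ℝ (Fin d)} (hl : l ∈ torusLattice u) :
    (∀ i, ⌊gridForm u m o Q i x - gridOffset m M Q i⌋ =
      ⌊gridForm u m o Q i (y + l) - gridOffset m M Q i⌋) ↔
    (u.repr l o = ⌊u.repr x o⌋ - ⌊u.repr y o⌋ ∧
      ∀ q ∈ Q, u.repr l q = ⌊u.repr x q⌋ - ⌊u.repr y q⌋) ∧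
    strip m M (Int.fract (u.repr x o)) = strip m M (Int.fract (u.repr y o)) := by
  choose z hz using (mem_torusLattice_iff u).1 hl
  have h1 : ∀ k, (u.repr l k = ⌊u.repr x k⌋ - ⌊u.repr y k⌋ ↔
      ⌊u.repr x k⌋ = ⌊u.repr y k⌋ + z k) := by
    intro k
    rw [← hz k]
    constructor
    · intro h
      have : z k = ⌊u.repr x k⌋ - ⌊u.repr y k⌋ := by exact_mod_cast h
      omega
    · intro h
      rw [h]; push_cast; ring
  have hfr : ∀ (w : EuclideanSpace ℝ (Fin d)) (i : Fin m),
      ⌊u.repr w o - ((i : ℕ) : ℝ) / M⌋ =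
        ⌊Int.fract (u.repr w o) - ((i : ℕ) : ℝ) / M⌋ + ⌊u.repr w o⌋ := by
    intro w i
    rw [← Int.floor_add_intCast]
    congr 1
    rw [Int.fract]; ring
  have hinl : ∀ i : Fin m, (⌊gridForm u m o Q (Sum.inl i) x - gridOffset m M Q (Sum.inl i)⌋ =
      ⌊gridForm u m o Q (Sum.inl i) (y + l) - gridOffset m M Q (Sum.inl i)⌋) ↔
      ⌊Int.fract (u.repr x o) - ((i : ℕ) : ℝ) / M⌋ + ⌊u.repr x o⌋ =
        ⌊Int.fract (u.repr y o) - ((i : ℕ) : ℝ) / M⌋ + ⌊u.repr y o⌋ + z o := by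
    intro i
    rw [floor_add_of_integral (z := z o) _ (by simp [gridForm, hz])]
    simp only [gridForm, gridOffset, Sum.elim_inl, Basis.coord_apply]
    rw [hfr x, hfr y]
  have hinr : ∀ q : Q, (⌊gridForm u m o Q (Sum.inr q) x - gridOffset m M Q (Sum.inr q)⌋ =
      ⌊gridForm u m o Q (Sum.inr q) (y + l) - gridOffset m M Q (Sum.inr q)⌋) ↔
      ⌊u.repr x q⌋ = ⌊u.repr y q⌋ + z q := by
    intro q
    rw [floor_add_of_integral (z := z q) _ (by simp [gridForm, hz])]
    simp [gridForm, gridOffset]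
  rw [strip_eq_iff hm hmM ⟨Int.fract_nonneg _, Int.fract_lt_one _⟩
    ⟨Int.fract_nonneg _, Int.fract_lt_one _⟩]
  simp only [Sum.forall, hinl, hinr, h1, Subtype.forall]
  constructor
  · rintro ⟨h2, h3⟩
    have h4 := h2 ⟨0, hm⟩
    simp only [Nat.cast_zero, zero_div, sub_zero, Int.floor_fract, zero_add] at h4
    exact ⟨⟨h4, h3⟩, fun i => by have := h2 i; omega⟩
  · rintro ⟨⟨h4, h3⟩, h2⟩
    exact ⟨fun i => by rw [h2 i]; omega, h3⟩

theorem generic_grid_point {m M : ℕ} (hmM : m ≤ M) {o : Fin d} {Q : Finset (Fin d)}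
    {y : Fin d → ℝ} (hy : ∀ k, 0 < y k ∧ y k < 1) (ho : ∀ i : ℕ, i < m → (M : ℝ) * y o ≠ i)
    (i : Fin m ⊕ Q) (z : ℤ) :
    gridForm u m o Q i (point u y) - gridOffset m M Q i ≠ z := by
  intro hz
  rcases i with i | q
  · simp only [gridForm, gridOffset, Sum.elim_inl, Basis.coord_apply, repr_point] at hz
    have hiM : (i : ℕ) < M := i.2.trans_le hmM
    have hM : (0 : ℝ) < M := by exact_mod_cast (show 0 < M by omega)
    have h1 : (0 : ℝ) ≤ ((i : ℕ) : ℝ) / M := by positivity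
    have h2 : ((i : ℕ) : ℝ) / M < 1 := by
      rw [div_lt_one hM]; exact_mod_cast hiM
    have h3 : z < 1 := by
      have : (z : ℝ) < 1 := by linarith [(hy o).2]
      exact_mod_cast this
    have h4 : -1 < z := by
      have : (-1 : ℝ) < z := by linarith [(hy o).1]
      exact_mod_cast this
    obtain rfl : z = 0 := by omega
    refine ho i i.2 ?_
    field_simp at hz
    push_cast at hz
    linarith
  · simp only [gridForm, gridOffset, Sum.elim_inr, Basis.coord_apply, repr_point, sub_zero] at hz
    exact ne_int_of_mem_Ioo (w := 0) (by simpa using hy q) z hz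

theorem card_components_grid {m : ℕ} (hm : 0 < m) {o : Fin d} {Q : Finset (Fin d)} (hoQ : o ∉ Q) :
    ENat.card (ConnectedComponents (Complement u (gridForm u m o Q) (gridOffset m m Q))) = m := by
  have hA := isArrangement_grid (u := u) (le_refl m) hoQ
  refine hA.card_eq (fun x => strip m m (Int.fract (u.repr x o))) ?_ ?_ ?_
  · intro x _
    exact (min_le_right _ _).trans_lt (by omega)
  · intro j hj
    have hm' : (0 : ℝ) < m := by exact_mod_cast hm
    have hj' : (j : ℝ) + 1 ≤ m := by exact_mod_cast hj
    have hval : (m : ℝ) * (((j : ℝ) + 1 / 2) / m) = j + 1 / 2 := by field_simp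
    have h01 : 0 < ((j : ℝ) + 1 / 2) / m ∧ ((j : ℝ) + 1 / 2) / m < 1 := by
      refine ⟨by positivity, ?_⟩
      rw [div_lt_one hm']; linarith
    -- The middle of the `j`-th strip.
    refine ⟨point u fun _ => ((j : ℝ) + 1 / 2) / m, fun i _ => ?_, ?_⟩
    · refine generic_grid_point le_rfl (fun _ => h01) (fun i _ h => ?_) i
      rw [hval] at h
      have h2 : 2 * j + 1 = 2 * i := by
        have : (2 : ℝ) * j + 1 = 2 * i := by linarith
        exact_mod_cast this
      omega
    · rw [repr_point, Int.fract_eq_self.2 ⟨h01.1.le, h01.2⟩, strip, hval,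
        (Nat.floor_eq_iff (by positivity)).2 (show (j : ℝ) ≤ _ ∧ _ by constructor <;> linarith)]
      omega
  · intro x y _ _
    constructor
    · intro h
      refine ⟨_, point_mem fun k => ⌊u.repr x k⌋ - ⌊u.repr y k⌋, fun i _ => ?_⟩
      exact (grid_floor_iff hm le_rfl (point_mem _)).2 ⟨⟨by simp, fun q _ => by simp⟩, h⟩ i
    · rintro ⟨l, hl, h⟩
      exact ((grid_floor_iff hm le_rfl hl).1 fun i => h i (Finset.mem_univ i)).2

end Grid

/-! ### Grids with one oblique hyperplane. -/

section Oblique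

/-- The grid together with the form `k x_o + x_p`. -/
noncomputable def obliqueForm (u : Basis (Fin d) ℝ (EuclideanSpace ℝ (Fin d))) (m k : ℕ)
    (o p : Fin d) (Q : Finset (Fin d)) :
    Option (Fin m ⊕ Q) → Dual ℝ (EuclideanSpace ℝ (Fin d)) :=
  fun i => i.elim ((k : ℝ) • u.coord o + u.coord p) (gridForm u m o Q)

/-- The offsets of the grid and of the oblique hyperplane. -/
noncomputable def obliqueOffset (m M : ℕ) (Q : Finset (Fin d)) : Option (Fin m ⊕ Q) → ℝ :=
  fun i => i.elim (1 / 2) (gridOffset m M Q)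

/-- The oblique form is 1 on `u p`, so proportionality to a coordinate form means equality. This
happens for `k = 0`, where the offset `1/2` keeps the two hyperplanes distinct. -/
theorem isArrangement_oblique {m M : ℕ} (k : ℕ) (hmM : m ≤ M) {o p : Fin d} {Q : Finset (Fin d)}
    (hoQ : o ∉ Q) (hpQ : p ∈ Q) :
    IsArrangement (torusLattice u) (obliqueForm u m k o p Q) (obliqueOffset m M Q) := by
  have hA := isArrangement_grid (u := u) hmM hoQ
  have hop : o ≠ p := by rintro rfl; exact hoQ hpQ
  set g : Dual ℝ (EuclideanSpace ℝ (Fin d)) := (k : ℝ) • u.coord o + u.coord p with hg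
  have hgo : g (u o) = k := by simp [hg, hop]
  have hgp : g (u p) = 1 := by simp [hg, hop.symm]
  have hcp : ∀ q, u.coord q (u p) = if q = p then 1 else 0 := fun q => by
    simp [Finsupp.single_apply, eq_comm]
  have hcoord : ∀ i, ∃ q, gridForm u m o Q i = u.coord q := by
    rintro (i | q)
    exacts [⟨o, rfl⟩, ⟨q, rfl⟩]
  have key : ∀ i (r : ℝ), g = r • gridForm u m o Q i → g = gridForm u m o Q i := by
    intro i r h
    obtain ⟨q, hq⟩ := hcoord i
    rw [hq] at h ⊢
    have h1 := LinearMap.congr_fun h (u p)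
    rw [LinearMap.smul_apply, hgp, hcp] at h1
    split_ifs at h1 with hqp
    · rw [h, show r = 1 by simpa using h1.symm]
      exact one_smul ℝ _
    · simp at h1
  have key' : ∀ i (r : ℝ), gridForm u m o Q i = r • g → gridForm u m o Q i = g := by
    intro i r h
    refine (key i r⁻¹ ?_).symm
    have hr : r ≠ 0 := by
      rintro rfl
      exact hA.ne_zero i (h.trans (zero_smul ℝ g))
    rw [h]
    exact (inv_smul_smul₀ hr g).symm
  have hdist : ∀ i, g = gridForm u m o Q i → gridOffset m M Q i = 0 := by
    rintro (i | q) h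
    · have h1 := LinearMap.congr_fun h (u p)
      simp [hgp, gridForm, hop.symm] at h1
    · rfl
  have hhalf : ∀ z : ℤ, (1 / 2 : ℝ) ≠ z := ne_int_of_mem_Ioo (w := 0) (by norm_num)
  refine ⟨?_, ?_, ?_, ?_⟩
  · rintro (_ | i) l hl
    · obtain ⟨z, hz⟩ := (mem_torusLattice_iff u).1 hl o
      obtain ⟨w, hw⟩ := (mem_torusLattice_iff u).1 hl p
      exact ⟨k * z + w, by simp [obliqueForm, hz, hw]⟩
    · exact hA.integral i l hl
  · rintro (_ | i)
    · exact ⟨u p, Submodule.subset_span ⟨p, rfl⟩, hgp⟩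
    · exact hA.primitive i
  · rintro (_ | i) (_ | j) r h
    · rfl
    · exact key j r h
    · exact key' i r h
    · exact hA.eq_of_proportional i j r h
  · rintro (_ | i) (_ | j) hij h z hz
    · exact hij rfl
    · have hj : gridOffset m M Q j = 0 := hdist j h
      refine hhalf z ?_
      simpa [obliqueOffset, hj] using hz
    · have hi : gridOffset m M Q i = 0 := hdist i h.symm
      refine hhalf (-z) ?_
      simp only [obliqueOffset, Option.elim_some, Option.elim_none, hi] at hz
      push_cast; linarith
    · exact hA.distinct i j (fun h' => hij (congrArg some h')) h z hz

theorem oblique_floor_iff {m M k : ℕ} {o p : Fin d} {Q : Finset (Fin d)}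
    {x y l : EuclideanSpace ℝ (Fin d)} {zo zp : ℤ} (ho : u.repr l o = zo) (hp : u.repr l p = zp) :
    ⌊obliqueForm u m k o p Q none x - obliqueOffset m M Q none⌋ =
      ⌊obliqueForm u m k o p Q none (y + l) - obliqueOffset m M Q none⌋ ↔
    ⌊k * u.repr x o + u.repr x p - 1 / 2⌋ =
      ⌊k * u.repr y o + u.repr y p - 1 / 2⌋ + (k * zo + zp) := by
  rw [floor_add_of_integral (z := k * zo + zp) _ (by simp [obliqueForm, ho, hp])]
  simp [obliqueForm, obliqueOffset]

theorem floor_oblique_fract (k : ℕ) (s t : ℝ) :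
    ⌊k * s + t - 1 / 2⌋ = ⌊k * Int.fract s + Int.fract t - 1 / 2⌋ + (k * ⌊s⌋ + ⌊t⌋) := by
  rw [← Int.floor_add_intCast]
  congr 1
  rw [Int.fract, Int.fract]; push_cast; ring

/-- The number of the region in the oblique arrangement with parallel hyperplanes. -/
noncomputable def obliqueIndex (m k : ℕ) (s t : ℝ) : ℕ :=
  2 * strip m (2 * m * (k + 1)) s + (⌊k * s + t - 1 / 2⌋ + 1).toNat

/-- With `M = 2m(k + 1)` the parallels are crowded into `s < 1/(2(k + 1))`, where `k s < 1/2`. Hence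
all strips but the last see only the levels `-1, 0`, while the last sees at most `-1, …, k`: in all
`2(m - 1) + (k + 2) = 2m + k`. -/
theorem oblique_bounds {m k : ℕ} (hm : 0 < m) {s t : ℝ} (hs : 0 ≤ s ∧ s < 1)
    (ht : 0 ≤ t ∧ t < 1) :
    -1 ≤ ⌊k * s + t - 1 / 2⌋ ∧ ⌊k * s + t - 1 / 2⌋ ≤ k ∧
      strip m (2 * m * (k + 1)) s ≤ m - 1 ∧
      (strip m (2 * m * (k + 1)) s < m - 1 → ⌊k * s + t - 1 / 2⌋ ≤ 0) := by
  have hk : (0 : ℝ) ≤ k := by positivity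
  have hks : 0 ≤ k * s := mul_nonneg hk hs.1
  have hks' : k * s ≤ k := by nlinarith [hs.2]
  refine ⟨?_, ?_, min_le_right _ _, fun hlt => ?_⟩
  · rw [Int.le_floor]; push_cast; linarith [ht.1]
  · rw [← Int.lt_add_one_iff, Int.floor_lt]; push_cast; linarith [ht.2]
  · have h1 : ¬ (m - 1) ≤ strip m (2 * m * (k + 1)) s := by omega
    rw [le_strip_iff (by positivity) hs.1 (by omega), not_le, lt_div_iff₀ (by positivity)] at h1
    have h2 : ((m - 1 : ℕ) : ℝ) ≤ m := by exact_mod_cast Nat.sub_le m 1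
    have hm' : (0 : ℝ) < m := by exact_mod_cast hm
    push_cast at h1
    have h3 : s * (2 * (k + 1)) < 1 := by
      by_contra hcon
      push Not at hcon
      nlinarith
    rw [← Int.lt_add_one_iff, Int.floor_lt]; push_cast
    nlinarith [ht.2, hs.1]

theorem obliqueIndex_eq_iff {m k : ℕ} (hm : 0 < m) {s t s' t' : ℝ} (hs : 0 ≤ s ∧ s < 1)
    (ht : 0 ≤ t ∧ t < 1) (hs' : 0 ≤ s' ∧ s' < 1) (ht' : 0 ≤ t' ∧ t' < 1) :
    obliqueIndex m k s t = obliqueIndex m k s' t' ↔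
      strip m (2 * m * (k + 1)) s = strip m (2 * m * (k + 1)) s' ∧
        ⌊k * s + t - 1 / 2⌋ = ⌊k * s' + t' - 1 / 2⌋ := by
  obtain ⟨h1, h2, h3, h4⟩ := oblique_bounds (k := k) hm hs ht
  obtain ⟨h1', h2', h3', h4'⟩ := oblique_bounds (k := k) hm hs' ht'
  rw [obliqueIndex, obliqueIndex]
  omega

theorem obliqueIndex_lt {m k : ℕ} (hm : 0 < m) {s t : ℝ} (hs : 0 ≤ s ∧ s < 1)
    (ht : 0 ≤ t ∧ t < 1) : obliqueIndex m k s t < 2 * m + k := by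
  obtain ⟨h1, h2, h3, h4⟩ := oblique_bounds (k := k) hm hs ht
  rw [obliqueIndex]
  omega

theorem exists_obliqueIndex_eq {m k : ℕ} (hm : 0 < m) {j : ℕ} (hj : j < 2 * m + k) :
    ∃ s t : ℝ, (0 < s ∧ s < 1) ∧ (0 < t ∧ t < 1) ∧
      (∀ i : ℕ, i < m → ((2 * m * (k + 1) : ℕ) : ℝ) * s ≠ i) ∧
      (∀ z : ℤ, k * s + t - 1 / 2 ≠ z) ∧ obliqueIndex m k s t = j := by
  have hm' : (1 : ℝ) ≤ m := by exact_mod_cast hm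
  have hk : (0 : ℝ) ≤ k := by positivity
  have hfin : ∀ (s t : ℝ) (w : ℤ), k * s + t - 1 / 2 ∈ Set.Ioo (w : ℝ) (w + 1) →
      (∀ z : ℤ, k * s + t - 1 / 2 ≠ z) ∧ ⌊k * s + t - 1 / 2⌋ = w := fun s t w h =>
    ⟨ne_int_of_mem_Ioo h, Int.floor_eq_iff.2 ⟨h.1.le, h.2⟩⟩
  by_cases hlow : j < 2 * m
  · obtain ⟨q, b, hb, rfl⟩ : ∃ q b, b < 2 ∧ j = 2 * q + b :=
      ⟨j / 2, j % 2, Nat.mod_lt _ two_pos, (Nat.div_add_mod j 2).symm⟩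
    have hq : (q : ℝ) + 1 ≤ m := by exact_mod_cast (show q + 1 ≤ m by omega)
    -- Here `k s < 1/2`, so `t` can be taken below or above the line `k s + t = 1/2`, for levels
    -- `-1` and `0`.
    let s : ℝ := (q + 1 / 2) / ((2 * m * (k + 1) : ℕ) : ℝ)
    have hMpos : (0 : ℝ) < ((2 * m * (k + 1) : ℕ) : ℝ) := by positivity
    have hval : ((2 * m * (k + 1) : ℕ) : ℝ) * s = q + 1 / 2 := by
      simp only [s]; field_simp
    have hs0 : 0 < s := by positivity
    have hks : s * (2 * (k + 1)) < 1 := by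
      push_cast at hval
      by_contra hcon
      push Not at hcon
      nlinarith
    have hks' : k * s < 1 / 2 := by nlinarith
    have hks0 : 0 ≤ k * s := by positivity
    have hs1 : s < 1 := by nlinarith
    have hstrip : strip m (2 * m * (k + 1)) s = q := by
      rw [strip, hval, (Nat.floor_eq_iff (by positivity)).2
        (show (q : ℝ) ≤ _ ∧ _ by constructor <;> linarith)]
      omega
    have hne : ∀ i : ℕ, i < m → ((2 * m * (k + 1) : ℕ) : ℝ) * s ≠ i := by
      intro i _ h
      rw [hval] at h
      have h2 : 2 * q + 1 = 2 * i := by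
        have : (2 : ℝ) * q + 1 = 2 * i := by linarith
        exact_mod_cast this
      omega
    interval_cases b
    · obtain ⟨h1, h2⟩ := hfin s ((1 / 2 - k * s) / 2) (-1) (by
        constructor <;> push_cast <;> linarith)
      refine ⟨s, (1 / 2 - k * s) / 2, ⟨hs0, hs1⟩, ⟨by linarith, by linarith⟩, hne, h1, ?_⟩
      rw [obliqueIndex, hstrip, h2]; simp
    · obtain ⟨h1, h2⟩ := hfin s (3 / 4) 0 (by
        constructor <;> push_cast <;> linarith)
      refine ⟨s, 3 / 4, ⟨hs0, hs1⟩, ⟨by norm_num, by norm_num⟩, hne, h1, ?_⟩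
      rw [obliqueIndex, hstrip, h2]; simp
  · obtain ⟨w, rfl⟩ := Nat.exists_eq_add_of_le (not_lt.1 hlow)
    have hk1 : (1 : ℝ) ≤ k := by exact_mod_cast (show 1 ≤ k by omega)
    have hw : (w : ℝ) + 1 ≤ k := by exact_mod_cast (show w + 1 ≤ k by omega)
    have hw0 : (0 : ℝ) ≤ w := by positivity
    -- With `t = 3/4` this gives `k s + t - 1/2 = w + 9/8`, hence level `w + 1`, and `s` lies beyond
    -- all the parallels.
    let s : ℝ := (w + 7 / 8) / k
    have hks : k * s = w + 7 / 8 := by simp only [s]; field_simp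
    have hs0 : 0 < s := by positivity
    have hs1 : s < 1 := by
      simp only [s]; rw [div_lt_one (by linarith)]; linarith
    have hMs : (m : ℝ) < ((2 * m * (k + 1) : ℕ) : ℝ) * s := by
      push_cast
      have : (1 : ℝ) < 2 * (k * s) := by rw [hks]; linarith
      nlinarith
    obtain ⟨h1, h2⟩ := hfin s (3 / 4) (w + 1) (by
      constructor <;> push_cast <;> linarith)
    have hstrip : strip m (2 * m * (k + 1)) s = m - 1 := by
      rw [strip]
      have : m ≤ ⌊((2 * m * (k + 1) : ℕ) : ℝ) * s⌋₊ := Nat.le_floor hMs.le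
      omega
    refine ⟨s, 3 / 4, ⟨hs0, hs1⟩, ⟨by norm_num, by norm_num⟩, fun i hi h => ?_, h1, ?_⟩
    · have : (i : ℝ) < m := by exact_mod_cast hi
      linarith
    · rw [obliqueIndex, hstrip, h2]
      omega

theorem card_components_oblique {m : ℕ} (k : ℕ) (hm : 0 < m) {o p : Fin d} {Q : Finset (Fin d)}
    (hoQ : o ∉ Q) (hpQ : p ∈ Q) :
    ENat.card (ConnectedComponents (Complement u (obliqueForm u m k o p Q)
      (obliqueOffset m (2 * m * (k + 1)) Q))) = (2 * m + k : ℕ) := by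
  have hmM : m ≤ 2 * m * (k + 1) := by nlinarith
  have hop : o ≠ p := by rintro rfl; exact hoQ hpQ
  have hA := isArrangement_oblique (u := u) k hmM hoQ hpQ
  have hfr : ∀ t : ℝ, 0 ≤ Int.fract t ∧ Int.fract t < 1 := fun t =>
    ⟨Int.fract_nonneg _, Int.fract_lt_one _⟩
  refine hA.card_eq (fun x => obliqueIndex m k (Int.fract (u.repr x o)) (Int.fract (u.repr x p)))
    ?_ ?_ ?_
  · intro x _
    exact obliqueIndex_lt hm (hfr _) (hfr _)
  · intro j hj
    obtain ⟨s, t, hs, ht, hne, hgen, hidx⟩ := exists_obliqueIndex_eq hm hj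
    let y : Fin d → ℝ := fun q => if q = o then s else t
    have hyo : y o = s := by simp [y]
    have hyp : y p = t := by simp [y, hop.symm]
    refine ⟨point u y, ?_, ?_⟩
    · rintro (_ | i) _
      · simpa [obliqueForm, obliqueOffset, hyo, hyp] using hgen
      · refine generic_grid_point hmM (fun q => ?_) (by rw [hyo]; exact hne) i
        by_cases hq : q = o
        · simpa [y, hq] using hs
        · simpa [y, hq] using ht
    · simp only [repr_point, hyo, hyp]
      rw [Int.fract_eq_self.2 ⟨hs.1.le, hs.2⟩, Int.fract_eq_self.2 ⟨ht.1.le, ht.2⟩, hidx]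
  · intro x y _ _
    rw [obliqueIndex_eq_iff hm (hfr _) (hfr _) (hfr _) (hfr _)]
    constructor
    · rintro ⟨h1, h2⟩
      refine ⟨_, point_mem fun q => ⌊u.repr x q⌋ - ⌊u.repr y q⌋, ?_⟩
      rintro (_ | i) _
      · rw [oblique_floor_iff (zo := ⌊u.repr x o⌋ - ⌊u.repr y o⌋)
          (zp := ⌊u.repr x p⌋ - ⌊u.repr y p⌋) (by simp) (by simp),
          floor_oblique_fract k (u.repr x o), floor_oblique_fract k (u.repr y o), h2]
        ring
      · exact (grid_floor_iff hm hmM (point_mem _)).2 ⟨⟨by simp, fun q _ => by simp⟩, h1⟩ i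
    · rintro ⟨l, hl, h⟩
      obtain ⟨⟨h1, h2⟩, h3⟩ := (grid_floor_iff hm hmM hl).1
        fun i => h (some i) (Finset.mem_univ _)
      refine ⟨h3, ?_⟩
      have h4 := h none (Finset.mem_univ _)
      rw [oblique_floor_iff (zo := ⌊u.repr x o⌋ - ⌊u.repr y o⌋)
          (zp := ⌊u.repr x p⌋ - ⌊u.repr y p⌋) (by rw [h1]; push_cast; rfl)
          (by rw [h2 p hpQ]; push_cast; rfl),
          floor_oblique_fract k (u.repr x o), floor_oblique_fract k (u.repr y o)] at h4
      linarith

/-- With no hyperplane in direction `o`, integer translations along `u o` are free and change the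
oblique level by multiples of `k`. Once the floor of `x_p` is matched, the invariant is the level
minus that floor, modulo `k`. -/
theorem card_components_two {k : ℕ} (hk : 0 < k) {o p : Fin d} {Q : Finset (Fin d)}
    (hoQ : o ∉ Q) (hpQ : p ∈ Q) :
    ENat.card (ConnectedComponents (Complement u (obliqueForm u 0 k o p Q)
      (obliqueOffset 0 0 Q))) = k := by
  have hop : o ≠ p := by rintro rfl; exact hoQ hpQ
  have hA := isArrangement_oblique (u := u) k (le_refl 0) hoQ hpQ
  have hk0 : (k : ℤ) ≠ 0 := by omega
  have hk' : (0 : ℝ) < k := by exact_mod_cast hk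
  refine hA.card_eq (fun x => ((⌊k * u.repr x o + u.repr x p - 1 / 2⌋ - ⌊u.repr x p⌋) % k).toNat)
    ?_ ?_ ?_
  · intro x _
    have h1 := Int.emod_nonneg (⌊k * u.repr x o + u.repr x p - 1 / 2⌋ - ⌊u.repr x p⌋) hk0
    have h2 := Int.emod_lt_of_pos (⌊k * u.repr x o + u.repr x p - 1 / 2⌋ - ⌊u.repr x p⌋)
      (show (0 : ℤ) < k by omega)
    omega
  · intro j hj
    have hj' : (j : ℝ) + 1 ≤ k := by exact_mod_cast hj
    let y : Fin d → ℝ := fun q => if q = o then ((j : ℝ) + 3 / 4) / k else 1 / 2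
    have hyo : y o = ((j : ℝ) + 3 / 4) / k := by simp [y]
    have hyp : y p = 1 / 2 := by simp [y, hop.symm]
    have hval : (k : ℝ) * (((j : ℝ) + 3 / 4) / k) + 1 / 2 - 1 / 2 = j + 3 / 4 := by
      field_simp; ring
    refine ⟨point u y, ?_, ?_⟩
    · rintro (_ | i) _
      · intro z
        have h1 : obliqueForm u 0 k o p Q none (point u y) - obliqueOffset 0 0 Q none =
            j + 3 / 4 := by
          rw [← hval]
          simp [obliqueForm, obliqueOffset, hyo, hyp]
        rw [h1]
        exact ne_int_of_mem_Ioo (w := j) (by constructor <;> push_cast <;> linarith) z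
      · refine generic_grid_point le_rfl (fun q => ?_) (by simp) i
        by_cases hq : q = o
        · simp only [y, hq, if_true]
          exact ⟨by positivity, by rw [div_lt_one hk']; linarith⟩
        · simp only [y, hq, if_false]; norm_num
    · simp only [repr_point, hyo, hyp, hval]
      rw [Int.floor_eq_iff.2 (show ((j : ℤ) : ℝ) ≤ _ ∧ _ by constructor <;> push_cast <;> linarith),
        show ⌊(1 / 2 : ℝ)⌋ = 0 by norm_num, sub_zero, Int.emod_eq_of_lt (by omega) (by omega)]
      simp
  · intro x y _ _
    have h1 := Int.emod_nonneg (⌊k * u.repr x o + u.repr x p - 1 / 2⌋ - ⌊u.repr x p⌋) hk0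
    have h2 := Int.emod_nonneg (⌊k * u.repr y o + u.repr y p - 1 / 2⌋ - ⌊u.repr y p⌋) hk0
    have hq : ∀ (q : Q) (l : EuclideanSpace ℝ (Fin d)) (z : ℤ), u.repr l q = z →
        (⌊obliqueForm u 0 k o p Q (some (Sum.inr q)) x - obliqueOffset 0 0 Q (some (Sum.inr q))⌋ =
        ⌊obliqueForm u 0 k o p Q (some (Sum.inr q)) (y + l) -
          obliqueOffset 0 0 Q (some (Sum.inr q))⌋ ↔ ⌊u.repr x q⌋ = ⌊u.repr y q⌋ + z) := by
      intro q l z hz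
      rw [floor_add_of_integral (z := z) _ (by simpa [obliqueForm, gridForm] using hz)]
      simp [obliqueForm, obliqueOffset, gridForm, gridOffset]
    have hmod : ((⌊k * u.repr x o + u.repr x p - 1 / 2⌋ - ⌊u.repr x p⌋) % k).toNat =
        ((⌊k * u.repr y o + u.repr y p - 1 / 2⌋ - ⌊u.repr y p⌋) % k).toNat ↔
        (k : ℤ) ∣ (⌊k * u.repr x o + u.repr x p - 1 / 2⌋ - ⌊u.repr x p⌋) -
          (⌊k * u.repr y o + u.repr y p - 1 / 2⌋ - ⌊u.repr y p⌋) := by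
      rw [← Int.modEq_iff_dvd, Int.ModEq]
      omega
    simp only [hmod]
    constructor
    · rintro ⟨w, hw⟩
      -- The free coordinate `o` absorbs the quotient `w`; the other coordinates match integer
      -- parts.
      let z : Fin d → ℤ := fun q => if q = o then w else ⌊u.repr x q⌋ - ⌊u.repr y q⌋
      refine ⟨_, point_mem z, ?_⟩
      rintro (_ | i | q) _
      · rw [oblique_floor_iff (zo := w) (zp := ⌊u.repr x p⌋ - ⌊u.repr y p⌋) (by simp [z])
          (by simp [z, hop.symm])]
        linarith
      · exact i.elim0
      · have hqo : (q : Fin d) ≠ o := by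
          intro h; exact hoQ (h ▸ q.2)
        rw [hq q _ (⌊u.repr x q⌋ - ⌊u.repr y q⌋) (by simp [z, hqo])]
        ring
    · rintro ⟨l, hl, h⟩
      obtain ⟨zo, hzo⟩ := (mem_torusLattice_iff u).1 hl o
      obtain ⟨zp, hzp⟩ := (mem_torusLattice_iff u).1 hl p
      have h3 := (oblique_floor_iff hzo.symm hzp.symm).1 (h none (Finset.mem_univ _))
      have h4 := (hq ⟨p, hpQ⟩ l zp hzp.symm).1 (h _ (Finset.mem_univ _))
      simp only at h4
      exact ⟨zo, by linarith⟩

end Oblique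

/-! ### Choosing parameters in every case. -/

section Existence

theorem grid_mem_componentNumbers {m e : ℕ} (hm : 0 < m) (he : e + 1 ≤ d) :
    (m : ℕ∞) ∈ componentNumbers u (m + e) := by
  let o : Fin d := ⟨0, by omega⟩
  obtain ⟨Q, hQ, hQe⟩ := Finset.exists_subset_card_eq (s := Finset.univ.erase o) (n := e) (by
    rw [Finset.card_erase_of_mem (Finset.mem_univ o), Finset.card_univ, Fintype.card_fin]; omega)
  have hoQ : o ∉ Q := fun h => Finset.notMem_erase o _ (hQ h)
  exact mem_componentNumbers (isArrangement_grid le_rfl hoQ) (by simp [hQe])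
    (card_components_grid hm hoQ)

theorem oblique_mem_componentNumbers {m e k : ℕ} (hmk : 0 < m ∨ 0 < k) (he : e + 2 ≤ d) :
    ((2 * m + k : ℕ) : ℕ∞) ∈ componentNumbers u (m + 2 + e) := by
  let o : Fin d := ⟨0, by omega⟩
  obtain ⟨Q, hQ, hQe⟩ := Finset.exists_subset_card_eq (s := Finset.univ.erase o) (n := e + 1) (by
    rw [Finset.card_erase_of_mem (Finset.mem_univ o), Finset.card_univ, Fintype.card_fin]; omega)
  have hoQ : o ∉ Q := fun h => Finset.notMem_erase o _ (hQ h)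
  obtain ⟨p, hpQ⟩ := Finset.card_pos.1 (show 0 < Q.card by omega)
  have hcard : Fintype.card (Option (Fin m ⊕ Q)) = m + 2 + e := by
    simp [hQe]; omega
  rcases Nat.eq_zero_or_pos m with rfl | hm
  · have hk := hmk.resolve_left (lt_irrefl 0)
    rw [show 2 * 0 + k = k by omega]
    exact mem_componentNumbers (isArrangement_oblique k le_rfl hoQ hpQ) hcard
      (card_components_two hk hoQ hpQ)
  · exact mem_componentNumbers (isArrangement_oblique k (by nlinarith) hoQ hpQ) hcard
      (card_components_oblique k hm hoQ hpQ)

theorem eq_one_of_mem_componentNumbers_one {f : ℕ∞}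
    (hf : f ∈ componentNumbers u 1) : f = 1 := by
  obtain ⟨N, rfl, h1, h2 | h2⟩ := bounds_of_mem_componentNumbers le_rfl hf
  · obtain ⟨A, hinj, hcod, hN⟩ := hf
    obtain ⟨a, c, hA, hAc⟩ := exists_isArrangement hinj hcod
    obtain rfl : A = fun i => subtorus u (a i) (c i) := funext hAc
    have := hA.card_le (by simpa using hA.atMost_one_singleton 0)
    have h3 : (N : ℕ∞) ≤ (1 : ℕ) := hN.symm.le.trans this
    have h4 : N ≤ 1 := by exact_mod_cast h3
    exact_mod_cast (show N = 1 by omega)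
  · exact_mod_cast (show N = 1 by omega)

end Existence

end Examples

end ToralArrangement

open ToralArrangement in
theorem mainTheorem1 (d : ℕ) (u : Module.Basis (Fin d) ℝ (EuclideanSpace ℝ (Fin d))) :
    (∀ n : ℕ, 2 ≤ d → d < n →
      componentNumbers u n =
        ((fun l : ℕ => (l : ℕ∞)) '' {l : ℕ | (n - d + 1 ≤ l ∧ l ≤ n) ∨ 2 * (n - d) ≤ l})) ∧
    (∀ n : ℕ, 2 ≤ n → n ≤ d →
      componentNumbers u n = ((fun l : ℕ => (l : ℕ∞)) '' {l : ℕ | 1 ≤ l})) ∧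
    (1 ≤ d → componentNumbers u 1 = {1}) := by
  refine ⟨fun n hd hn => ?_, fun n hn hd => ?_, fun hd => ?_⟩
  · apply Set.Subset.antisymm
    · intro f hf
      obtain ⟨N, rfl, h1, h2⟩ := bounds_of_mem_componentNumbers (by omega) hf
      refine ⟨N, ?_, rfl⟩
      rcases h2 with h2 | h2
      · exact Or.inr h2
      · exact Or.inl ⟨by omega, h2⟩
    · rintro _ ⟨l, ⟨h1, h2⟩ | h1, rfl⟩
      · obtain ⟨e, rfl⟩ := Nat.exists_eq_add_of_le h2
        exact grid_mem_componentNumbers (by omega) (by omega)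
      · obtain ⟨k, rfl⟩ := Nat.exists_eq_add_of_le h1
        have := oblique_mem_componentNumbers (u := u) (m := n - d) (e := d - 2) (k := k)
          (by omega) (by omega)
        rwa [show n - d + 2 + (d - 2) = n by omega] at this
  · apply Set.Subset.antisymm
    · intro f hf
      obtain ⟨N, rfl, h1, -⟩ := bounds_of_mem_componentNumbers (by omega) hf
      exact ⟨N, show 1 ≤ N by omega, rfl⟩
    · rintro _ ⟨l, hl, rfl⟩
      have hl' : 1 ≤ l := hl
      have := oblique_mem_componentNumbers (u := u) (m := 0) (e := n - 2) (k := l)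
        (by omega) (by omega)
      rwa [show 0 + 2 + (n - 2) = n by omega, show 2 * 0 + l = l by omega] at this
  · apply Set.Subset.antisymm
    · intro f hf
      exact eq_one_of_mem_componentNumbers_one hf
    · rintro _ rfl
      simpa using grid_mem_componentNumbers (u := u) (m := 1) (e := 0) one_pos (by omega)
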